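/- Setting. $(U,A,Z,W,Y,C)$ are random variables on a standard Borel probability space: $U$ is a latent confounder, $A$ the treatment, $Z$ and $W$ the treatment- and outcome-inducing proxies ($W$ takes values in a standard Borel space), $Y$ the real outcome, and $C$ the variable on which a measurable policy $\pi:\mathcal C\to\mathcal A$ acts. Assume $Y\perp Z\mid (A,U)$, $W\perp (A,Z)\mid U$ and $C\perp W\mid U$. The value of the policy is $v(\pi)=\mathbb E_{U,C}\big[\mathbb E[Y\mid A=\pi(C),U]\big]$, where the law of $(\pi(C),U)$ is assumed absolutely continuous with respect to that of $(A,U)$, so that $v(\pi)$ is well defined. Completeness. (a) For each treatment level, the confounder is complete: for measurable $l(a,u)$ with $\mathbb E[l(A,U)^2]<\infty$, $\mathbb E[l(A,U)\mid A,Z]=0$ a.s. iff $l(A,U)=0$ a.s. (b) For $l$ with $\mathbb E[l(W)^2]<\infty$, $\mathbb E[l(W)\mid A,Z]=0$ a.s. iff $l=0$ $P_W$-a.e. Let $h^*$ be a bridge function, that is, a jointly measurable function with $\mathbb E[h^*(A,W)^2]<\infty$ and $\mathbb E[Y\mid A,Z]=\mathbb E[h^*(A,W)\mid A,Z]$ a.s.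 Model. Let $\phi_{\theta_{A(1)}},\phi_{\theta_Z},\psi_{\theta_{A(2)}},\psi_{\theta_W}$ be finite-dimensional feature maps, measurable in the input and continuous in their real parameter vectors. The parameters $(V,\theta_{A(1)},\theta_Z)$, $(u,\theta_{A(2)})$ and $\theta_W$ range over given sets $\Theta_1$, $\Theta_2$, $\Theta_W$. The stage 1 predictions are $g(a,z)=V(\phi_{\theta_{A(1)}}(a)\otimes\phi_{\theta_Z}(z))$ and the bridge models are $h(a,w)=u^\top(\psi_{\theta_{A(2)}}(a)\otimes\psi_{\theta_W}(w))$. Put $$\mathcal H_1=\{(w,a,z)\mapsto\|\psi_{\theta_W}(w)-g(a,z)\|^2\},\qquad \mathcal H_2=\{(y,a,z)\mapsto (y-u^\top(\psi_{\theta_{A(2)}}(a)\otimes g(a,z)))^2\},$$ $$\kappa_1=\sup_{\theta_W}\inf_{g}\mathbb E\big\|\mathbb E[\psi_{\theta_W}(W)\mid A,Z]-g(A,Z)\big\|^2,\qquad \kappa_2=\inf_{h}\big\|\mathbb E[Y\mid A,Z]-\mathbb E[h(A,W)\mid A,Z]\big\|_{L^2}.$$ The empirical Rademacher complexity of a class $\mathcal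 G$ on a sample $S=(s_i)_{i\le n}$ is $\hat{\mathfrak R}_S(\mathcal G)=\mathbb E_\sigma\sup_{f\in\mathcal G}\frac1n\sum_i\sigma_i f(s_i)$, with $\sigma_i$ independent and uniform on $\{-1,1\}$. Boundedness, ill-posedness and policy conditions. Let $M\in\mathbb R$ and $\tau,\rho\in[0,\infty)$, and assume: 1. $|Y|\le M$ a.s., and everywhere $\|g(a,z)\|\le1$, $\|\psi_{\theta_W}(w)\|\le1$, and $v\mapsto u^\top(\psi_{\theta_{A(2)}}(a)\otimes v)$ has norm at most $M$; 2. for every $h$ in the model, $\|h^*-h\|_{L^2(P_{A,W})}\le\tau\,\|\mathbb E[(h^*-h)(A,W)\mid A,Z]\|_{L^2}$; 3. the law of $(\pi(C),W)$ has a density $r_\pi$ with respect to $P_{A,W}$, and $\|r_\pi\|_{L^2(P_{A,W})}\le\rho$. Estimator. Let $m,n,n'\ge1$, and let $S_1=\{(w_i,a_i,z_i)\}_{i=1}^m$, $S_2=\{(\tilde y_i,\tilde a_i,\tilde z_i)\}_{i=1}^n$ and $S_3=\{(\check c_i,\check w_i)\}_{i=1}^{n'}$ each be i.i.d. from the laws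 of $(W,A,Z)$, $(Y,A,Z)$ and $(C,W)$. For each $\theta_W$ let $\hat g_{\theta_W}$, with matrix $\hat V$, minimize $\frac1m\sum_i\|\psi_{\theta_W}(w_i)-g(a_i,z_i)\|^2+\lambda_1\|V\|^2$ over $\Theta_1$. Let $(\hat u,\hat\theta_{A(2)},\hat\theta_W)$ minimize $\frac1n\sum_i(\tilde y_i-u^\top(\psi_{\theta_{A(2)}}(\tilde a_i)\otimes\hat g_{\theta_W}(\tilde a_i,\tilde z_i)))^2+\lambda_2\|u\|^2$ over $\Theta_2\times\Theta_W$. The regularization is negligible: $\lambda_1,\lambda_2\ge0$, with $\lambda_1\|V\|^2\le m^{-1/2}$ and $\lambda_2\|u\|^2\le n^{-1/2}$ on the parameter sets (for example $\lambda_1=\lambda_2=0$). The sample $S_3$ is held out: $(\hat u,\hat\theta_{A(2)},\hat\theta_W)$ is measurable and independent of $S_3$. Put $$\hat v(\pi)=\frac1{n'}\sum_{i=1}^{n'}\hat u^\top\big(\psi_{\hat\theta_{A(2)}}(\pi(\check c_i))\otimes\psi_{\hat\theta_W}(\check w_i)\big).$$ Claim. Then $$|v(\pi)-\hat v(\pi)|\le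 O_p\left(\sqrt{\kappa_1+\hat{\mathfrak R}_{S_1}(\mathcal H_1)+\tfrac1{\sqrt m}}+\kappa_2+\sqrt{\hat{\mathfrak R}_{S_2}(\mathcal H_2)+\tfrac1{\sqrt n}}+\tfrac1{\sqrt{n'}}\right),$$ that is, for every $\delta>0$ there is a constant $K$ such that for all $m,n,n'\ge1$ the left side exceeds $K$ times the bracket with probability at most $\delta$. For given underlying spaces, $K$ depends only on $\delta,M,\tau,\rho$, and not on the distributions, the model, the policy or the sample sizes. -/

import Mathlib

open MeasureTheory ProbabilityTheory
open scoped ENNReal NNReal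

namespace DFPV

noncomputable section

/-- One draw from the population: the latent confounder `U`, the treatment `A`, the
treatment-inducing proxy `Z`, the outcome-inducing proxy `W`, the outcome `Y`, and the variable
`C` on which a policy acts. -/
structure Population (Ω 𝒰 𝒜 𝒵 𝒲 𝒞 : Type*) [MeasurableSpace Ω] [MeasurableSpace 𝒰]
    [MeasurableSpace 𝒜] [MeasurableSpace 𝒵] [MeasurableSpace 𝒲] [MeasurableSpace 𝒞] where
  μ : Measure Ω
  prob : IsProbabilityMeasure μ
  U : Ω → 𝒰
  A : Ω → 𝒜
  Z : Ω → 𝒵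
  W : Ω → 𝒲
  Y : Ω → ℝ
  C : Ω → 𝒞
  measurable_U : Measurable U
  measurable_A : Measurable A
  measurable_Z : Measurable Z
  measurable_W : Measurable W
  measurable_Y : Measurable Y
  measurable_C : Measurable C

attribute [instance] Population.prob

namespace Population

variable {Ω 𝒰 𝒜 𝒵 𝒲 𝒞 : Type*} [MeasurableSpace Ω] [MeasurableSpace 𝒰]
  [MeasurableSpace 𝒜] [MeasurableSpace 𝒵] [MeasurableSpace 𝒲] [MeasurableSpace 𝒞]

/-- `Y ⟂ Z | (A, U)` and `W ⟂ (A, Z) | U`. -/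
def Structural [StandardBorelSpace Ω] (P : Population Ω 𝒰 𝒜 𝒵 𝒲 𝒞) : Prop :=
  CondIndepFun (MeasurableSpace.comap (fun ω => (P.A ω, P.U ω)) inferInstance)
      (P.measurable_A.prodMk P.measurable_U).comap_le P.Y P.Z P.μ ∧
    CondIndepFun (MeasurableSpace.comap P.U inferInstance)
      P.measurable_U.comap_le P.W (fun ω => (P.A ω, P.Z ω)) P.μ

/-- `C ⟂ W | U`. -/
def PolicyVariableIndep [StandardBorelSpace Ω] (P : Population Ω 𝒰 𝒜 𝒵 𝒲 𝒞) : Prop :=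
  CondIndepFun (MeasurableSpace.comap P.U inferInstance)
    P.measurable_U.comap_le P.C P.W P.μ

/-- The σ-algebra generated by `(A, Z)`. -/
abbrev sigmaAZ (P : Population Ω 𝒰 𝒜 𝒵 𝒲 𝒞) : MeasurableSpace Ω :=
  MeasurableSpace.comap (fun ω => (P.A ω, P.Z ω)) inferInstance

/-- Completeness on the confounder: at every treatment level `a` (up to null sets), the only
square-integrable `l(a, ·)` with `E[l(a, U) | A = a, Z] = 0` is zero. The functions at all levels
`a` are collected in one measurable `l(a, u)`. -/
def ConfounderComplete (P : Population Ω 𝒰 𝒜 𝒵 𝒲 𝒞) : Prop :=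
  ∀ l : 𝒜 × 𝒰 → ℝ, Measurable l → MemLp (fun ω => l (P.A ω, P.U ω)) 2 P.μ →
    (P.μ[fun ω => l (P.A ω, P.U ω) | P.sigmaAZ] =ᵐ[P.μ] 0 ↔
      (fun ω => l (P.A ω, P.U ω)) =ᵐ[P.μ] 0)

/-- Completeness on the outcome-inducing proxy: for square-integrable `l : 𝒲 → ℝ`,
`E[l(W) | A, Z] = 0` if and only if `l = 0` almost everywhere for the law of `W`. -/
def ProxyComplete (P : Population Ω 𝒰 𝒜 𝒵 𝒲 𝒞) : Prop :=
  ∀ l : 𝒲 → ℝ, Measurable l → MemLp l 2 (P.μ.map P.W) →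
    (P.μ[fun ω => l (P.W ω) | P.sigmaAZ] =ᵐ[P.μ] 0 ↔ l =ᵐ[P.μ.map P.W] 0)

/-- `h` is a bridge function: jointly measurable, square-integrable, and
`E[Y | A, Z] = E[h(A, W) | A, Z]`. -/
def IsBridge (P : Population Ω 𝒰 𝒜 𝒵 𝒲 𝒞) (h : 𝒜 × 𝒲 → ℝ) : Prop :=
  Measurable h ∧ MemLp (fun ω => h (P.A ω, P.W ω)) 2 P.μ ∧
    P.μ[P.Y | P.sigmaAZ] =ᵐ[P.μ] P.μ[fun ω => h (P.A ω, P.W ω) | P.sigmaAZ]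

/-- The regression function `(a, u) ↦ E[Y | A = a, U = u]`. -/
def outcomeMean (P : Population Ω 𝒰 𝒜 𝒵 𝒲 𝒞) (x : 𝒜 × 𝒰) : ℝ :=
  ∫ y, y ∂(condDistrib P.Y (fun ω => (P.A ω, P.U ω)) P.μ x)

/-- The value `v(π) = E_{U,C}[E[Y | A = π(C), U]]` of the policy `π`. -/
def value (P : Population Ω 𝒰 𝒜 𝒵 𝒲 𝒞) (π : 𝒞 → 𝒜) : ℝ :=
  ∫ ω, P.outcomeMean (π (P.C ω), P.U ω) ∂P.μ

/-- Overlap: the law of `(π(C), U)` is absolutely continuous with respect to the law of `(A, U)`,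
so that `E[Y | A = π(C), U]` does not depend on the version of `E[Y | A = a, U = u]`. -/
def Overlap (P : Population Ω 𝒰 𝒜 𝒵 𝒲 𝒞) (π : 𝒞 → 𝒜) : Prop :=
  P.μ.map (fun ω => (π (P.C ω), P.U ω)) ≪ P.μ.map (fun ω => (P.A ω, P.U ω))

/-- The law of `(π(C), W)` has a density `r_π` with respect to the law of `(A, W)`, and the
`L²`-norm of `r_π` with respect to the law of `(A, W)` is at most `ρ`. -/
def PolicyL2 (P : Population Ω 𝒰 𝒜 𝒵 𝒲 𝒞) (π : 𝒞 → 𝒜) (ρ : ℝ≥0) : Prop :=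
  P.μ.map (fun ω => (π (P.C ω), P.W ω)) ≪ P.μ.map (fun ω => (P.A ω, P.W ω)) ∧
    ∫⁻ x, ((P.μ.map (fun ω => (π (P.C ω), P.W ω))).rnDeriv
      (P.μ.map (fun ω => (P.A ω, P.W ω))) x) ^ 2 ∂(P.μ.map (fun ω => (P.A ω, P.W ω)))
      ≤ (ρ : ℝ≥0∞) ^ 2

end Population

/-- The Kronecker product of two vectors. -/
def kron {p q : ℕ} (x : Fin p → ℝ) (y : Fin q → ℝ) : Fin p × Fin q → ℝ :=
  fun ij => x ij.1 * y ij.2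

/-- The squared Euclidean norm. -/
def sqNorm {ι : Type*} [Fintype ι] (x : ι → ℝ) : ℝ := ∑ i, x i ^ 2

/-- The squared Frobenius norm. -/
def sqFrob {ι κ : Type*} [Fintype ι] [Fintype κ] (V : Matrix ι κ ℝ) : ℝ := ∑ i, ∑ j, V i j ^ 2

/-- Four parametrized feature maps (neural nets, continuous in their real weights and measurable in
their input), `φA, φZ` for stage 1 and `ψA, ψW` for stage 2, with the sets of parameters
`(V, θ_{A(1)}, θ_Z)`, `(u, θ_{A(2)})` and `θ_W` over which the losses are minimized. -/
structure FeatureModel (𝒜 𝒵 𝒲 : Type*) [MeasurableSpace 𝒜] [MeasurableSpace 𝒵]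
    [MeasurableSpace 𝒲] where
  (dφA dφZ dψA dψW : ℕ)
  (pφA pφZ pψA pψW : ℕ)
  φA : (Fin pφA → ℝ) → 𝒜 → Fin dφA → ℝ
  φZ : (Fin pφZ → ℝ) → 𝒵 → Fin dφZ → ℝ
  ψA : (Fin pψA → ℝ) → 𝒜 → Fin dψA → ℝ
  ψW : (Fin pψW → ℝ) → 𝒲 → Fin dψW → ℝ
  measurable_φA : ∀ θ, Measurable (φA θ)
  measurable_φZ : ∀ θ, Measurable (φZ θ)
  measurable_ψA : ∀ θ, Measurable (ψA θ)
  measurable_ψW : ∀ θ, Measurable (ψW θ)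
  continuous_φA : ∀ a, Continuous fun θ => φA θ a
  continuous_φZ : ∀ z, Continuous fun θ => φZ θ z
  continuous_ψA : ∀ a, Continuous fun θ => ψA θ a
  continuous_ψW : ∀ w, Continuous fun θ => ψW θ w
  stage1 : Set (Matrix (Fin dψW) (Fin dφA × Fin dφZ) ℝ × (Fin pφA → ℝ) × (Fin pφZ → ℝ))
  stage2 : Set ((Fin dψA × Fin dψW → ℝ) × (Fin pψA → ℝ))
  ΘW : Set (Fin pψW → ℝ)

namespace FeatureModel

variable {𝒜 𝒵 𝒲 : Type*} [MeasurableSpace 𝒜] [MeasurableSpace 𝒵] [MeasurableSpace 𝒲]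

/-- Stage 1 parameters `(V, θ_{A(1)}, θ_Z)`. -/
abbrev Par1 (F : FeatureModel 𝒜 𝒵 𝒲) : Type :=
  Matrix (Fin F.dψW) (Fin F.dφA × Fin F.dφZ) ℝ × (Fin F.pφA → ℝ) × (Fin F.pφZ → ℝ)

/-- Stage 2 parameters `(u, θ_{A(2)})`. -/
abbrev Par2 (F : FeatureModel 𝒜 𝒵 𝒲) : Type :=
  (Fin F.dψA × Fin F.dψW → ℝ) × (Fin F.pψA → ℝ)

/-- Weights `θ_W` of the features of `W`. -/
abbrev ParW (F : FeatureModel 𝒜 𝒵 𝒲) : Type := Fin F.pψW → ℝ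

/-- The stage 1 prediction `V (φ_{θ_{A(1)}}(a) ⊗ φ_{θ_Z}(z))`. -/
def pred1 (F : FeatureModel 𝒜 𝒵 𝒲) (p : F.Par1) (a : 𝒜) (z : 𝒵) : Fin F.dψW → ℝ :=
  p.1.mulVec (kron (F.φA p.2.1 a) (F.φZ p.2.2 z))

/-- The stage 2 prediction `uᵀ (ψ_{θ_{A(2)}}(a) ⊗ V (φ_{θ_{A(1)}}(a) ⊗ φ_{θ_Z}(z)))`. -/
def pred2 (F : FeatureModel 𝒜 𝒵 𝒲) (q : F.Par2) (p : F.Par1) (a : 𝒜) (z : 𝒵) : ℝ :=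
  q.1 ⬝ᵥ kron (F.ψA q.2 a) (F.pred1 p a z)

/-- The bridge function model `h(a, w) = uᵀ (ψ_{θ_{A(2)}}(a) ⊗ ψ_{θ_W}(w))`. -/
def bridge (F : FeatureModel 𝒜 𝒵 𝒲) (q : F.Par2) (θW : F.ParW) (x : 𝒜 × 𝒲) : ℝ :=
  q.1 ⬝ᵥ kron (F.ψA q.2 x.1) (F.ψW θW x.2)

/-- The stage 1 loss at one observation `(w, a, z)`. -/
def loss1 (F : FeatureModel 𝒜 𝒵 𝒲) (θW : F.ParW) (p : F.Par1) (x : 𝒲 × 𝒜 × 𝒵) : ℝ :=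
  sqNorm (F.ψW θW x.1 - F.pred1 p x.2.1 x.2.2)

/-- The stage 2 loss at one observation `(y, a, z)`. -/
def loss2 (F : FeatureModel 𝒜 𝒵 𝒲) (q : F.Par2) (p : F.Par1) (x : ℝ × 𝒜 × 𝒵) : ℝ :=
  (x.1 - F.pred2 q p x.2.1 x.2.2) ^ 2

/-- The class of stage 1 losses. -/
def H1 (F : FeatureModel 𝒜 𝒵 𝒲) : Set (𝒲 × 𝒜 × 𝒵 → ℝ) :=
  {f | ∃ θW ∈ F.ΘW, ∃ p ∈ F.stage1, f = F.loss1 θW p}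

/-- The class of stage 2 losses. -/
def H2 (F : FeatureModel 𝒜 𝒵 𝒲) : Set (ℝ × 𝒜 × 𝒵 → ℝ) :=
  {f | ∃ q ∈ F.stage2, ∃ p ∈ F.stage1, f = F.loss2 q p}

/-- Boundedness of the hypothesis spaces: the stage 1 predictions and the features of `W` have
Euclidean norm at most `1`, and `v ↦ uᵀ (ψ_{θ_{A(2)}}(a) ⊗ v)` has operator norm at most `M`. -/
def Bounded (F : FeatureModel 𝒜 𝒵 𝒲) (M : ℝ) : Prop :=
  (∀ p ∈ F.stage1, ∀ a z, sqNorm (F.pred1 p a z) ≤ 1) ∧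
    (∀ θW ∈ F.ΘW, ∀ w, sqNorm (F.ψW θW w) ≤ 1) ∧
    (∀ q ∈ F.stage2, ∀ a, sqNorm (fun j => ∑ i, q.1 (i, j) * F.ψA q.2 a i) ≤ M ^ 2)

/-- The empirical stage 1 loss with targets `ψ_{θ_W}(w_i)` and ridge parameter `lam`. -/
def empLoss1 (F : FeatureModel 𝒜 𝒵 𝒲) {m : ℕ} (S : Fin m → 𝒲 × 𝒜 × 𝒵) (lam : ℝ) (θW : F.ParW)
    (p : F.Par1) : ℝ :=
  (1 / (m : ℝ)) * ∑ i, F.loss1 θW p (S i) + lam * sqFrob p.1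

/-- The empirical stage 2 loss with ridge parameter `lam`. It depends on `θ_W` through the stage 1
solution `est θ_W`. -/
def empLoss2 (F : FeatureModel 𝒜 𝒵 𝒲) {n : ℕ} (S : Fin n → ℝ × 𝒜 × 𝒵) (lam : ℝ)
    (est : F.ParW → F.Par1) (r : F.Par2 × F.ParW) : ℝ :=
  (1 / (n : ℝ)) * ∑ i, F.loss2 r.1 (est r.2) (S i) + lam * sqNorm r.1.1

/-- `est θ_W` minimizes the empirical stage 1 loss for each `θ_W`. -/
def IsStage1Minimizer (F : FeatureModel 𝒜 𝒵 𝒲) {m : ℕ} (S : Fin m → 𝒲 × 𝒜 × 𝒵) (lam : ℝ)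
    (est : F.ParW → F.Par1) : Prop :=
  ∀ θW ∈ F.ΘW, est θW ∈ F.stage1 ∧ IsMinOn (F.empLoss1 S lam θW) F.stage1 (est θW)

/-- `r = (u, θ_{A(2)}, θ_W)` minimizes the empirical stage 2 loss. -/
def IsStage2Minimizer (F : FeatureModel 𝒜 𝒵 𝒲) {n : ℕ} (S : Fin n → ℝ × 𝒜 × 𝒵) (lam : ℝ)
    (est : F.ParW → F.Par1) (r : F.Par2 × F.ParW) : Prop :=
  r ∈ F.stage2 ×ˢ F.ΘW ∧ IsMinOn (F.empLoss2 S lam est) (F.stage2 ×ˢ F.ΘW) r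

/-- The estimate `v̂(π)`, the average of the learned bridge function over the sample `S`. -/
def estValue {𝒞 : Type*} (F : FeatureModel 𝒜 𝒵 𝒲) (π : 𝒞 → 𝒜) (r : F.Par2 × F.ParW) {n : ℕ}
    (S : Fin n → 𝒞 × 𝒲) : ℝ :=
  (1 / (n : ℝ)) * ∑ i, F.bridge r.1 r.2 (π (S i).1, (S i).2)

variable {Ω 𝒰 𝒞 : Type*} [MeasurableSpace Ω] [MeasurableSpace 𝒰] [MeasurableSpace 𝒞]

/-- Stage 1 misspecification: the largest, over `θ_W`, of the smallest mean squared distances from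
`E[ψ_{θ_W}(W) | A, Z]` to a stage 1 prediction. -/
def kappa1 (F : FeatureModel 𝒜 𝒵 𝒲) (P : Population Ω 𝒰 𝒜 𝒵 𝒲 𝒞) : ℝ :=
  ⨆ θW : F.ΘW, ⨅ p : F.stage1,
    ∫ ω, ∑ j, ((P.μ[fun ω' => F.ψW θW (P.W ω') j | P.sigmaAZ]) ω
      - F.pred1 p (P.A ω) (P.Z ω) j) ^ 2 ∂P.μ

/-- Stage 2 misspecification: the smallest `L²` distance from `E[Y | A, Z]` to `E[h(A, W) | A, Z]`,
over the bridge functions `h` in the model. -/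
def kappa2 (F : FeatureModel 𝒜 𝒵 𝒲) (P : Population Ω 𝒰 𝒜 𝒵 𝒲 𝒞) : ℝ :=
  ⨅ r : (F.stage2 ×ˢ F.ΘW : Set (F.Par2 × F.ParW)),
    Real.sqrt (∫ ω, ((P.μ[P.Y | P.sigmaAZ]) ω
      - (P.μ[fun ω' => F.bridge r.1.1 r.1.2 (P.A ω', P.W ω') | P.sigmaAZ]) ω) ^ 2 ∂P.μ)

/-- The measure of ill-posedness: the largest ratio of `‖h* - h‖` to `‖E[(h* - h)(A, W) | A, Z]‖`
(both in `L²`), over the bridge functions `h` in the model; here `0 / 0 = 0` and `x / 0 = ∞` for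
`x ≠ 0`. -/
def illPosedness (F : FeatureModel 𝒜 𝒵 𝒲) (P : Population Ω 𝒰 𝒜 𝒵 𝒲 𝒞) (hstar : 𝒜 × 𝒲 → ℝ) :
    ℝ≥0∞ :=
  ⨆ r ∈ F.stage2 ×ˢ F.ΘW,
    eLpNorm (fun ω => hstar (P.A ω, P.W ω) - F.bridge r.1 r.2 (P.A ω, P.W ω)) 2 P.μ /
      eLpNorm (P.μ[fun ω => hstar (P.A ω, P.W ω) - F.bridge r.1 r.2 (P.A ω, P.W ω) | P.sigmaAZ])
        2 P.μ

end FeatureModel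

/-- The empirical Rademacher complexity
`E_σ[sup_{f ∈ G} (1/n) ∑ i, σ_i f(S_i)]`, with `σ` uniform on `{-1, 1}ⁿ`. -/
def empRademacher {E : Type*} {n : ℕ} (G : Set (E → ℝ)) (S : Fin n → E) : ℝ :=
  (1 / (2 : ℝ) ^ n) * ∑ σ : Fin n → Bool,
    ⨆ f : G, (1 / (n : ℝ)) * ∑ i, (if σ i then (1 : ℝ) else -1) * (f : E → ℝ) (S i)

/-- `S` consists of independent observations with common law `ν`. -/
def IsIIDSample {Ω' E : Type*} [MeasurableSpace Ω'] [MeasurableSpace E] (Q : Measure Ω')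
    (ν : Measure E) {n : ℕ} (S : Fin n → Ω' → E) : Prop :=
  (∀ i, Measurable (S i)) ∧ iIndepFun S Q ∧ ∀ i, Q.map (S i) = ν

/-- The rate
`√(κ₁ + R̂_{S₁}(H₁) + 1/√m) + κ₂ + √(R̂_{S₂}(H₂) + 1/√n) + 1/√n'`. -/
def rate {Ω 𝒰 𝒜 𝒵 𝒲 𝒞 : Type*} [MeasurableSpace Ω] [MeasurableSpace 𝒰]
    [MeasurableSpace 𝒜] [MeasurableSpace 𝒵] [MeasurableSpace 𝒲] [MeasurableSpace 𝒞]
    (P : Population Ω 𝒰 𝒜 𝒵 𝒲 𝒞) (F : FeatureModel 𝒜 𝒵 𝒲) {m n : ℕ}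
    (S₁ : Fin m → 𝒲 × 𝒜 × 𝒵) (S₂ : Fin n → ℝ × 𝒜 × 𝒵) (n' : ℕ) : ℝ :=
  Real.sqrt (F.kappa1 P + empRademacher F.H1 S₁ + 1 / Real.sqrt m) + F.kappa2 P
    + Real.sqrt (empRademacher F.H2 S₂ + 1 / Real.sqrt n) + 1 / Real.sqrt n'

end

end DFPV

/-! Write ĥ for the learned bridge. The error is at most |v(π) − E ĥ(π(C), W)| plus the deviation of
v̂(π) from E ĥ(π(C), W), with ĥ held fixed in both expectations.

The first term rests on identification. Given the confounder, E[Y | A, U, Z] and E[h*(A, W) | U, A,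
Z] are both functions of (A, U), with equal projections on (A, Z) because h* is a bridge.
Completeness on U makes them equal (`outcomeMean_ae_eq_bridgeMean`). Overlap carries the equality to
(π(C), U), and C ⟂ W | U then gives v(π) = E h*(π(C), W) (`value_eq_integral_bridge`). So the first
term is a policy mean of h* − ĥ. Cauchy–Schwarz against r_π costs a factor ρ and ill-posedness a
factor τ, leaving ρτ ‖E[Y | A, Z] − E[ĥ | A, Z]‖ (`abs_value_sub_le`).

The projected error is controlled by two oracle inequalities. Each squared-loss risk is an excess
risk plus a noise term that does not see the prediction, so an empirical minimizer is optimal up to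
twice the uniform deviation Δ and the penalty. Stage 1 bounds the excess risk by D = κ₁ + 2Δ₁ + 1/√m
(`excess1_le_of_isStage1Minimizer`). Replacing E[ψ(W) | A, Z] by a stage 1 prediction costs M√D in
stage 2, once at the estimate and once at the comparator (`rms_outMean_sub_bridgeCond_le`).

The uniform deviations come from symmetrization (`integral_supDev_le`): the largest deviation minus
twice the empirical complexity has nonpositive mean. It also has bounded differences of order 1/n,
hence variance of order 1/n, and Chebyshev suffices because K may depend on δ in any way. Countable
index families keep the suprema measurable; continuity in the parameters recovers the full class
(`measure_uniform_deviation_le`). The second term is Chebyshev conditionally on the estimate, which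
is independent of the held-out sample (`measure_heldOut_avg_dev_gt_le`). -/

namespace DFPV

/-! ### Variance of functions with bounded differences -/

section BoundedDifferences

variable {E : Type*} [MeasurableSpace E]

/-- Changing one coordinate of the argument changes `F` by at most `c`. -/
def BoundedDiff {n : ℕ} (F : (Fin n → E) → ℝ) (c : ℝ) : Prop :=
  ∀ S i x, |F (Function.update S i x) - F S| ≤ c

theorem integrable_of_abs_le {α : Type*} [MeasurableSpace α] {μ : Measure α} [IsFiniteMeasure μ]
    {f : α → ℝ} (hf : Measurable f) {B : ℝ} (hB : ∀ x, |f x| ≤ B) : Integrable f μ :=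
  Integrable.of_bound hf.aestronglyMeasurable B (Filter.Eventually.of_forall hB)

theorem measurable_cons {n : ℕ} :
    Measurable fun p : E × (Fin n → E) => (Fin.cons p.1 p.2 : Fin (n + 1) → E) := by
  refine measurable_pi_iff.2 fun i => ?_
  refine Fin.cases ?_ (fun j => ?_) i
  · simpa using measurable_fst
  · simp only [Fin.cons_succ]
    exact (measurable_pi_apply j).comp measurable_snd

theorem integral_pi_cons {n : ℕ} (ν : Measure E) [IsProbabilityMeasure ν]
    {G : (Fin (n + 1) → E) → ℝ} (hG : Measurable G) {B : ℝ} (hB : ∀ S, |G S| ≤ B) :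
    ∫ S, G S ∂(Measure.pi fun _ => ν) =
      ∫ S, ∫ x, G (Fin.cons x S) ∂ν ∂(Measure.pi fun _ : Fin n => ν) := by
  have mp := (measurePreserving_piFinSuccAbove (fun _ : Fin (n + 1) => ν) 0).symm
  rw [← mp.integral_comp' G]
  have h : ∀ p : E × (Fin n → E), (MeasurableEquiv.piFinSuccAbove (fun _ => E) 0).symm p
      = (Fin.cons p.1 p.2 : Fin (n + 1) → E) := by
    intro p
    rw [MeasurableEquiv.piFinSuccAbove_symm_apply, Fin.insertNthEquiv_zero]
    rfl
  simp_rw [h]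
  exact integral_prod_symm (fun p : E × (Fin n → E) => G (Fin.cons p.1 p.2))
    (integrable_of_abs_le (hG.comp measurable_cons) fun p => hB _)

/-- A function of `n` independent variables with differences bounded by `c` has variance at most
`n c²`. -/
theorem integral_sq_le_of_boundedDiff (ν : Measure E) [IsProbabilityMeasure ν] {B c : ℝ} {n : ℕ}
    {F : (Fin n → E) → ℝ} (hF : Measurable F) (hB : ∀ S, |F S| ≤ B) (hc : BoundedDiff F c) :
    ∫ S, F S ^ 2 ∂(Measure.pi fun _ => ν) ≤
      (∫ S, F S ∂(Measure.pi fun _ => ν)) ^ 2 + n * c ^ 2 := by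
  induction n with
  | zero =>
    have h : ∀ S, F S = F Fin.elim0 := fun S => congrArg F (Subsingleton.elim _ _)
    simp_rw [h]
    simp
  | succ n ih =>
    have hsq : ∀ S, |F S ^ 2| ≤ B ^ 2 := fun S => by
      rw [abs_pow]
      exact pow_le_pow_left₀ (abs_nonneg _) (hB S) 2
    rw [integral_pi_cons ν hF hB, integral_pi_cons ν (hF.pow_const 2) hsq]
    have hFc : ∀ S : Fin n → E, Measurable fun x => F (Fin.cons x S) := fun S =>
      (hF.comp measurable_cons).comp (measurable_id.prodMk measurable_const)
    have hint : ∀ S : Fin n → E, Integrable (fun x => F (Fin.cons x S)) ν := fun S =>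
      integrable_of_abs_le (hFc S) fun x => hB _
    set g : (Fin n → E) → ℝ := fun S => ∫ x, F (Fin.cons x S) ∂ν with hg
    have hgm : Measurable g := by
      have : StronglyMeasurable fun p : (Fin n → E) × E => F (Fin.cons p.2 p.1) :=
        (hF.comp (measurable_cons.comp measurable_swap)).stronglyMeasurable
      exact this.integral_prod_right.measurable
    have hgB : ∀ S, |g S| ≤ B := fun S => by
      have := norm_integral_le_of_norm_le_const (μ := ν) (f := fun x => F (Fin.cons x S))
        (C := B) (Filter.Eventually.of_forall fun x => hB _)
      simpa using this
    have hgc : BoundedDiff g c := fun S i x => by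
      rw [hg]
      simp only
      rw [← integral_sub (hint _) (hint _)]
      have := norm_integral_le_of_norm_le_const (μ := ν)
        (f := fun y => F (Fin.cons y (Function.update S i x)) - F (Fin.cons y S))
        (C := c) (Filter.Eventually.of_forall fun y => by
          rw [Fin.cons_update]
          exact hc _ _ _)
      simpa using this
    -- With the other coordinates frozen, F stays within c of its mean g over the first one, so each
    -- coordinate adds at most c² to the variance.
    have hinner : ∀ S : Fin n → E, ∫ x, F (Fin.cons x S) ^ 2 ∂ν ≤ g S ^ 2 + c ^ 2 := fun S => by
      have hdev : ∀ y, |F (Fin.cons y S) - g S| ≤ c := fun y => by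
        have h1 : F (Fin.cons y S) - g S
            = ∫ x, (F (Fin.cons y S) - F (Fin.cons x S)) ∂ν := by
          rw [integral_sub (integrable_const _) (hint S)]
          simp [hg]
        rw [h1]
        have := norm_integral_le_of_norm_le_const (μ := ν)
          (f := fun x => F (Fin.cons y S) - F (Fin.cons x S))
          (C := c) (Filter.Eventually.of_forall fun x => by
            have := hc (Fin.cons x S) 0 y
            rwa [Fin.update_cons_zero] at this)
        simpa using this
      -- This is (F − g)² ≤ c² rearranged to be affine in F, so that integrating it uses only that F
      -- has mean g.
      have hle : ∀ y, F (Fin.cons y S) ^ 2 ≤ 2 * g S * F (Fin.cons y S) - g S ^ 2 + c ^ 2 :=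
        fun y => by nlinarith [sq_le_sq' (abs_le.1 (hdev y)).1 (abs_le.1 (hdev y)).2]
      calc ∫ x, F (Fin.cons x S) ^ 2 ∂ν
          ≤ ∫ x, (2 * g S * F (Fin.cons x S) - g S ^ 2 + c ^ 2) ∂ν :=
            integral_mono (integrable_of_abs_le ((hFc S).pow_const 2) fun x => hsq _)
              ((((hint S).const_mul _).sub (integrable_const _)).add (integrable_const _)) hle
        _ = g S ^ 2 + c ^ 2 := by
            have h1 : Integrable (fun x => 2 * g S * F (Fin.cons x S)) ν := (hint S).const_mul _
            rw [integral_add (f := fun x => 2 * g S * F (Fin.cons x S) - g S ^ 2)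
              (h1.sub (integrable_const _)) (integrable_const _),
              integral_sub h1 (integrable_const _), integral_const_mul]
            simp
            ring
    have hg2 : Integrable (fun S => g S ^ 2) (Measure.pi fun _ : Fin n => ν) :=
      integrable_of_abs_le (hgm.pow_const 2) (B := B ^ 2) fun S => by
        rw [abs_pow]
        exact pow_le_pow_left₀ (abs_nonneg _) (hgB S) 2
    calc ∫ S, ∫ x, F (Fin.cons x S) ^ 2 ∂ν ∂(Measure.pi fun _ : Fin n => ν)
        ≤ ∫ S, (g S ^ 2 + c ^ 2) ∂(Measure.pi fun _ : Fin n => ν) := by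
          refine integral_mono_of_nonneg (Filter.Eventually.of_forall fun S =>
            integral_nonneg fun x => sq_nonneg _) (hg2.add (integrable_const _))
            (Filter.Eventually.of_forall hinner)
      _ = ∫ S, g S ^ 2 ∂(Measure.pi fun _ : Fin n => ν) + c ^ 2 := by
          rw [integral_add hg2 (integrable_const _)]
          simp
      _ ≤ _ := by
          have := ih hgm hgB hgc
          push_cast
          linarith

/-- Chebyshev's inequality for a function with bounded differences and nonpositive mean. -/
theorem measure_gt_le_of_boundedDiff (ν : Measure E) [IsProbabilityMeasure ν] {B c η : ℝ} {n : ℕ}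
    {F : (Fin n → E) → ℝ} (hF : Measurable F) (hB : ∀ S, |F S| ≤ B) (hc : BoundedDiff F c)
    (hmean : ∫ S, F S ∂(Measure.pi fun _ => ν) ≤ 0) (hn : 0 < n) (hc0 : 0 < c) (hη : 0 < η) :
    (Measure.pi fun _ => ν) {S | c * Real.sqrt n / Real.sqrt η < F S} ≤ ENNReal.ofReal η := by
  set P : Measure (Fin n → E) := Measure.pi fun _ => ν
  have hL : MemLp F 2 P := MemLp.of_bound hF.aestronglyMeasurable B (Filter.Eventually.of_forall hB)
  have hn' : (0 : ℝ) < n := by exact_mod_cast hn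
  have ht : 0 < c * Real.sqrt n / Real.sqrt η := by positivity
  have hvar : variance F P ≤ n * c ^ 2 := by
    rw [variance_eq_sub hL]
    have := integral_sq_le_of_boundedDiff ν hF hB hc
    simp only [Pi.pow_apply]
    linarith
  calc P {S | c * Real.sqrt n / Real.sqrt η < F S}
      ≤ P {S | c * Real.sqrt n / Real.sqrt η ≤ |F S - P[F]|} := by
        refine measure_mono fun S hS => ?_
        simp only [Set.mem_ofPred_eq] at hS ⊢
        exact le_trans (by linarith) (le_abs_self _)
    _ ≤ ENNReal.ofReal (variance F P / (c * Real.sqrt n / Real.sqrt η) ^ 2) :=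
        meas_ge_le_variance_div_sq hL ht
    _ ≤ ENNReal.ofReal η := by
        refine ENNReal.ofReal_le_ofReal ?_
        rw [div_le_iff₀ (by positivity), div_pow, mul_pow, Real.sq_sqrt hn'.le,
          Real.sq_sqrt hη.le]
        refine hvar.trans (le_of_eq ?_)
        field_simp

end BoundedDifferences

/-! ### Rademacher complexity and largest deviation of an indexed family -/

section Rademacher

variable {E ι : Type*}

/-- The sign of a Boolean. -/
def sgn (b : Bool) : ℝ := if b then 1 else -1

theorem abs_sgn (b : Bool) : |sgn b| = 1 := by cases b <;> simp [sgn]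

theorem sgn_not (b : Bool) : sgn (!b) = -sgn b := by cases b <;> simp [sgn]

/-- The supremum over the family `f` of the average of `σ_j f(S_j)`. -/
noncomputable def signedSup {n : ℕ} (f : ι → E → ℝ) (σ : Fin n → Bool) (S : Fin n → E) : ℝ :=
  ⨆ i, (1 / (n : ℝ)) * ∑ j, sgn (σ j) * f i (S j)

/-- The empirical Rademacher complexity of a family of functions. -/
noncomputable def rad {n : ℕ} (f : ι → E → ℝ) (S : Fin n → E) : ℝ :=
  (1 / (2 : ℝ) ^ n) * ∑ σ : Fin n → Bool, signedSup f σ S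

theorem abs_avg_le {n : ℕ} {a : Fin n → ℝ} {B : ℝ} (hB0 : 0 ≤ B) (h : ∀ j, |a j| ≤ B) :
    |(1 / (n : ℝ)) * ∑ j, a j| ≤ B := by
  rcases Nat.eq_zero_or_pos n with rfl | hn
  · simpa using hB0
  have hn' : (0 : ℝ) < n := by exact_mod_cast hn
  rw [abs_mul, abs_of_pos (by positivity)]
  calc 1 / (n : ℝ) * |∑ j, a j| ≤ 1 / (n : ℝ) * ∑ _j : Fin n, B := by
        gcongr
        exact (Finset.abs_sum_le_sum_abs _ _).trans (Finset.sum_le_sum fun j _ => h j)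
    _ = B := by
        simp
        field_simp

theorem abs_iSup_le [Nonempty ι] {a : ι → ℝ} {B : ℝ} (h : ∀ i, |a i| ≤ B) : |⨆ i, a i| ≤ B := by
  have hb : BddAbove (Set.range a) := ⟨B, by rintro _ ⟨i, rfl⟩; exact (abs_le.1 (h i)).2⟩
  refine abs_le.2 ⟨?_, ciSup_le fun i => (abs_le.1 (h i)).2⟩
  obtain ⟨i⟩ := ‹Nonempty ι›
  exact (abs_le.1 (h i)).1.trans (le_ciSup hb i)

/-- The supremum is 1-Lipschitz for the uniform distance. Both families must be bounded, since the
real `iSup` of an unbounded one is 0. -/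
theorem abs_iSup_sub_iSup_le [Nonempty ι] {a b : ι → ℝ} {c : ℝ} (ha : BddAbove (Set.range a))
    (hb : BddAbove (Set.range b)) (h : ∀ i, |a i - b i| ≤ c) : |(⨆ i, a i) - ⨆ i, b i| ≤ c := by
  refine abs_sub_le_iff.2 ⟨?_, ?_⟩
  · refine sub_le_iff_le_add.2 (ciSup_le fun i => ?_)
    have := (abs_sub_le_iff.1 (h i)).1
    linarith [le_ciSup hb i]
  · refine sub_le_iff_le_add.2 (ciSup_le fun i => ?_)
    have := (abs_sub_le_iff.1 (h i)).2
    linarith [le_ciSup ha i]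

theorem bddAbove_of_abs_le {a : ι → ℝ} {B : ℝ} (h : ∀ i, |a i| ≤ B) : BddAbove (Set.range a) :=
  ⟨B, by rintro _ ⟨i, rfl⟩; exact (abs_le.1 (h i)).2⟩

/-- Flipping every sign permutes the sign patterns. This lets one complexity control both tails. -/
theorem rad_neg {n : ℕ} (f : ι → E → ℝ) (S : Fin n → E) : rad (fun i x => -f i x) S = rad f S := by
  unfold rad
  congr 1
  refine Fintype.sum_equiv (Equiv.piCongrRight fun _ : Fin n => Equiv.boolNot) _ _ fun σ => ?_
  unfold signedSup
  simp [sgn_not]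

variable {f : ι → E → ℝ} {B : ℝ} {n : ℕ}

theorem abs_signed_avg_le (hB0 : 0 ≤ B) (hB : ∀ i x, |f i x| ≤ B) (σ : Fin n → Bool)
    (S : Fin n → E) (i : ι) : |(1 / (n : ℝ)) * ∑ j, sgn (σ j) * f i (S j)| ≤ B :=
  abs_avg_le hB0 fun j => by rw [abs_mul, abs_sgn, one_mul]; exact hB i _

theorem abs_signedSup_le [Nonempty ι] (hB0 : 0 ≤ B) (hB : ∀ i x, |f i x| ≤ B) (σ : Fin n → Bool)
    (S : Fin n → E) : |signedSup f σ S| ≤ B :=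
  abs_iSup_le (abs_signed_avg_le hB0 hB σ S)

theorem abs_sign_average_le {a : (Fin n → Bool) → ℝ} {c : ℝ} (h : ∀ σ, |a σ| ≤ c) :
    |(1 / (2 : ℝ) ^ n) * ∑ σ, a σ| ≤ c := by
  rw [abs_mul, abs_of_pos (by positivity)]
  calc 1 / (2 : ℝ) ^ n * |∑ σ, a σ| ≤ 1 / (2 : ℝ) ^ n * ∑ _σ : Fin n → Bool, c := by
        gcongr
        exact (Finset.abs_sum_le_sum_abs _ _).trans (Finset.sum_le_sum fun j _ => h j)
    _ = c := by
        simp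

theorem abs_rad_le [Nonempty ι] (hB0 : 0 ≤ B) (hB : ∀ i x, |f i x| ≤ B) (S : Fin n → E) :
    |rad f S| ≤ B :=
  abs_sign_average_le fun σ => abs_signedSup_le hB0 hB σ S

theorem abs_avg_update_sub_le {S : Fin n → E} {k : Fin n} {x : E} {a : Fin n → ℝ} {g : E → ℝ}
    (ha : ∀ j, |a j| ≤ 1) (hg : ∀ x, |g x| ≤ B) :
    |(1 / (n : ℝ)) * ∑ j, a j * g (Function.update S k x j) - (1 / (n : ℝ)) * ∑ j, a j * g (S j)|
      ≤ 2 * B / n := by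
  have hn' : (0 : ℝ) < n := by exact_mod_cast k.pos
  rw [← mul_sub, ← Finset.sum_sub_distrib, Finset.sum_eq_single k]
  · rw [Function.update_self, ← mul_sub, abs_mul, abs_mul, abs_of_pos (by positivity),
      div_eq_mul_one_div (2 * B), mul_comm (2 * B)]
    refine mul_le_mul_of_nonneg_left ?_ (by positivity)
    have h2 : |g x - g (S k)| ≤ 2 * B := by
      have := abs_sub (g x) (g (S k))
      linarith [hg x, hg (S k)]
    calc |a k| * |g x - g (S k)| ≤ 1 * |g x - g (S k)| := by
          gcongr
          exact ha k
      _ ≤ 2 * B := by linarith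
  · intro j _ hj
    rw [Function.update_of_ne hj, sub_self]
  · simp

theorem boundedDiff_rad [Nonempty ι] [MeasurableSpace E] (hB0 : 0 ≤ B) (hB : ∀ i x, |f i x| ≤ B) :
    BoundedDiff (rad (n := n) f) (2 * B / n) := fun S k x => by
  unfold rad
  rw [← mul_sub, ← Finset.sum_sub_distrib]
  refine abs_sign_average_le fun σ => ?_
  exact abs_iSup_sub_iSup_le (bddAbove_of_abs_le (abs_signed_avg_le hB0 hB σ _))
    (bddAbove_of_abs_le (abs_signed_avg_le hB0 hB σ _)) fun i =>
      abs_avg_update_sub_le (fun j => (abs_sgn _).le) (hB i)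

variable [MeasurableSpace E]

theorem measurable_signedSup [Countable ι] (hf : ∀ i, Measurable (f i)) (σ : Fin n → Bool) :
    Measurable (signedSup f σ) :=
  Measurable.iSup fun i => (Finset.measurable_fun_sum _ fun j _ =>
    ((hf i).comp (measurable_pi_apply j)).const_mul _).const_mul _

theorem measurable_rad [Countable ι] (hf : ∀ i, Measurable (f i)) :
    Measurable (rad (n := n) f) :=
  (Finset.measurable_fun_sum _ fun σ _ => measurable_signedSup hf σ).const_mul _

/-- The largest excess, over the family `f`, of the mean over the empirical average. -/
noncomputable def supDev (ν : Measure E) (f : ι → E → ℝ) (S : Fin n → E) : ℝ :=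
  ⨆ i, (∫ x, f i x ∂ν - (1 / (n : ℝ)) * ∑ j, f i (S j))

theorem abs_integral_le_of_abs_le {α : Type*} [MeasurableSpace α] (μ : Measure α)
    [IsProbabilityMeasure μ] {g : α → ℝ} (hB : ∀ x, |g x| ≤ B) : |∫ x, g x ∂μ| ≤ B := by
  have := norm_integral_le_of_norm_le_const (μ := μ) (f := g) (C := B)
    (Filter.Eventually.of_forall hB)
  simpa using this

theorem abs_dev_le (ν : Measure E) [IsProbabilityMeasure ν] (hB0 : 0 ≤ B)
    (hB : ∀ i x, |f i x| ≤ B) (S : Fin n → E) (i : ι) :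
    |∫ x, f i x ∂ν - (1 / (n : ℝ)) * ∑ j, f i (S j)| ≤ 2 * B := by
  have h1 := abs_integral_le_of_abs_le ν (hB i)
  have h2 := abs_avg_le hB0 fun j => hB i (S j)
  have := abs_sub (∫ x, f i x ∂ν) ((1 / (n : ℝ)) * ∑ j, f i (S j))
  linarith

theorem boundedDiff_supDev [Nonempty ι] (ν : Measure E) [IsProbabilityMeasure ν] (hB0 : 0 ≤ B)
    (hB : ∀ i x, |f i x| ≤ B) :
    BoundedDiff (supDev (n := n) ν f) (2 * B / n) := fun S k x => by
  refine abs_iSup_sub_iSup_le (bddAbove_of_abs_le (abs_dev_le ν hB0 hB _))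
    (bddAbove_of_abs_le (abs_dev_le ν hB0 hB _)) fun i => ?_
  rw [sub_sub_sub_cancel_left, abs_sub_comm]
  simpa using abs_avg_update_sub_le (S := S) (k := k) (x := x) (a := fun _ => 1) (by simp) (hB i)

theorem measurable_supDev [Countable ι] (ν : Measure E) (hf : ∀ i, Measurable (f i)) :
    Measurable (supDev (n := n) ν f) :=
  Measurable.iSup fun i => ((Finset.measurable_fun_sum _ fun j _ =>
    (hf i).comp (measurable_pi_apply j)).const_mul _).const_sub _

end Rademacher

/-! ### Symmetrization by a ghost sample -/

section Symmetrization

variable {E ι : Type*} {f : ι → E → ℝ} {B : ℝ} {n : ℕ}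

/-- The differences of a family of functions, as functions of a pair of observations. -/
def pairDiff (f : ι → E → ℝ) (i : ι) (p : E × E) : ℝ := f i p.2 - f i p.1

theorem abs_pairDiff_le (hB : ∀ i x, |f i x| ≤ B) (i : ι) (p : E × E) :
    |pairDiff f i p| ≤ 2 * B := by
  have := abs_sub (f i p.2) (f i p.1)
  unfold pairDiff
  linarith [hB i p.1, hB i p.2]

variable [MeasurableSpace E]

theorem integral_comp_of_measurePreserving {α β : Type*} [MeasurableSpace α] [MeasurableSpace β]
    {μ : Measure α} {ν : Measure β} {φ : α → β} (hφ : MeasurePreserving φ μ ν) {g : β → ℝ}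
    (hg : Measurable g) : ∫ x, g (φ x) ∂μ = ∫ y, g y ∂ν := by
  rw [← hφ.map_eq, integral_map hφ.measurable.aemeasurable hg.aestronglyMeasurable]

theorem measurable_pairDiff (hf : ∀ i, Measurable (f i)) (i : ι) : Measurable (pairDiff f i) :=
  ((hf i).comp measurable_snd).sub ((hf i).comp measurable_fst)

theorem integral_avg_pi (ν : Measure E) [IsProbabilityMeasure ν] {g : E → ℝ} (hg : Measurable g)
    (hB : ∀ x, |g x| ≤ B) (hn : 0 < n) :
    ∫ S, (1 / (n : ℝ)) * ∑ j, g (S j) ∂(Measure.pi fun _ : Fin n => ν) = ∫ x, g x ∂ν := by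
  have hn' : (n : ℝ) ≠ 0 := by positivity
  rw [integral_const_mul, integral_finsetSum]
  · have : ∀ j : Fin n, ∫ S, g (S j) ∂(Measure.pi fun _ : Fin n => ν) = ∫ x, g x ∂ν := fun j =>
      integral_comp_of_measurePreserving (measurePreserving_eval (fun _ : Fin n => ν) j) hg
    simp_rw [this]
    simp
    field_simp
  · exact fun j _ => integrable_of_abs_le (hg.comp (measurable_pi_apply j)) fun S => hB _

/-- The mean is the expectation of the average over a ghost sample S', and a supremum of
expectations is at most the expectation of the supremum. -/
theorem supDev_le_integral [Countable ι] [Nonempty ι] (ν : Measure E) [IsProbabilityMeasure ν]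
    (hf : ∀ i, Measurable (f i)) (hB0 : 0 ≤ B) (hB : ∀ i x, |f i x| ≤ B) (hn : 0 < n)
    (S : Fin n → E) :
    supDev ν f S ≤ ∫ S', signedSup (pairDiff f) (fun _ => true) (fun j => (S j, S' j))
      ∂(Measure.pi fun _ : Fin n => ν) := by
  have hB2 : 0 ≤ 2 * B := by positivity
  refine ciSup_le fun i => ?_
  have hm : Measurable fun S' : Fin n → E => (1 / (n : ℝ)) * ∑ j, f i (S' j) :=
    (Finset.measurable_fun_sum _ fun j _ => (hf i).comp (measurable_pi_apply j)).const_mul _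
  have hint : Integrable (fun S' : Fin n → E => (1 / (n : ℝ)) * ∑ j, f i (S' j))
      (Measure.pi fun _ : Fin n => ν) :=
    integrable_of_abs_le hm fun S' => abs_avg_le hB0 fun j => hB i (S' j)
  have hpair : Measurable fun S' : Fin n → E => fun j => (S j, S' j) :=
    measurable_pi_iff.2 fun j => measurable_const.prodMk (measurable_pi_apply j)
  calc ∫ x, f i x ∂ν - (1 / (n : ℝ)) * ∑ j, f i (S j)
      = ∫ S', ((1 / (n : ℝ)) * ∑ j, f i (S' j) - (1 / (n : ℝ)) * ∑ j, f i (S j))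
          ∂(Measure.pi fun _ : Fin n => ν) := by
        rw [integral_sub hint (integrable_const _), integral_avg_pi ν (hf i) (hB i) hn]
        simp
    _ ≤ _ := by
        refine integral_mono (hint.sub (integrable_const _)) (integrable_of_abs_le
          ((measurable_signedSup (measurable_pairDiff hf) _).comp hpair) fun S' =>
            abs_signedSup_le hB2 (abs_pairDiff_le hB) _ _) fun S' => ?_
        refine le_trans (le_of_eq ?_) (le_ciSup (bddAbove_of_abs_le
          (abs_signed_avg_le hB2 (abs_pairDiff_le hB) _ _)) i)
        simp only [sgn, pairDiff, if_true, one_mul]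
        rw [← mul_sub, ← Finset.sum_sub_distrib]

/-- Exchanging the two observations of the pairs at which `σ` is `false`. -/
theorem measurePreserving_swap_where (ν : Measure E) [IsProbabilityMeasure ν] (σ : Fin n → Bool) :
    MeasurePreserving (fun (p : Fin n → E × E) j => if σ j then p j else (p j).swap)
      (Measure.pi fun _ => ν.prod ν) (Measure.pi fun _ => ν.prod ν) := by
  refine measurePreserving_pi (fun _ => ν.prod ν) (fun _ => ν.prod ν)
    (f := fun j q => if σ j then q else q.swap) fun j => ?_
  cases σ j
  · simpa using Measure.measurePreserving_swap
  · exact MeasurePreserving.id (ν.prod ν)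

/-- Exchanging the two observations of a pair preserves the law and flips the sign of the
difference, so every sign pattern has the same expectation. -/
theorem integral_signedSup_pairDiff_eq [Countable ι] (ν : Measure E) [IsProbabilityMeasure ν]
    (hf : ∀ i, Measurable (f i)) (σ : Fin n → Bool) :
    ∫ p, signedSup (pairDiff f) (fun _ => true) p ∂(Measure.pi fun _ : Fin n => ν.prod ν) =
      ∫ p, signedSup (pairDiff f) σ p ∂(Measure.pi fun _ : Fin n => ν.prod ν) := by
  rw [← integral_comp_of_measurePreserving (measurePreserving_swap_where ν σ)
    (measurable_signedSup (measurable_pairDiff hf) _)]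
  refine integral_congr_ae (Filter.Eventually.of_forall fun p => ?_)
  refine iSup_congr fun i => ?_
  congr 1
  refine Finset.sum_congr rfl fun j _ => ?_
  cases h : σ j <;> simp [sgn, pairDiff, h]

/-- Since σ(f(x') − f(x)) = σ f(x') + (−σ) f(x), subadditivity of the supremum separates the two
halves of the pairs, each an i.i.d. sample. -/
theorem integral_signedSup_pairDiff_le [Countable ι] [Nonempty ι] (ν : Measure E)
    [IsProbabilityMeasure ν] (hf : ∀ i, Measurable (f i)) (hB0 : 0 ≤ B)
    (hB : ∀ i x, |f i x| ≤ B) (σ : Fin n → Bool) :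
    ∫ p, signedSup (pairDiff f) σ p ∂(Measure.pi fun _ : Fin n => ν.prod ν) ≤
      ∫ S, signedSup f σ S ∂(Measure.pi fun _ => ν) +
        ∫ S, signedSup f (fun j => !σ j) S ∂(Measure.pi fun _ => ν) := by
  have hB2 : 0 ≤ 2 * B := by positivity
  have h1 : MeasurePreserving (fun (p : Fin n → E × E) j => (p j).1)
      (Measure.pi fun _ => ν.prod ν) (Measure.pi fun _ => ν) :=
    measurePreserving_pi _ _ fun j => measurePreserving_fst
  have h2 : MeasurePreserving (fun (p : Fin n → E × E) j => (p j).2)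
      (Measure.pi fun _ => ν.prod ν) (Measure.pi fun _ => ν) :=
    measurePreserving_pi _ _ fun j => measurePreserving_snd
  have hi1 : Integrable (fun p : Fin n → E × E => signedSup f (fun j => !σ j) fun j => (p j).1)
      (Measure.pi fun _ => ν.prod ν) :=
    integrable_of_abs_le ((measurable_signedSup hf _).comp h1.measurable)
      fun p => abs_signedSup_le hB0 hB _ _
  have hi2 : Integrable (fun p : Fin n → E × E => signedSup f σ fun j => (p j).2)
      (Measure.pi fun _ => ν.prod ν) :=
    integrable_of_abs_le ((measurable_signedSup hf _).comp h2.measurable)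
      fun p => abs_signedSup_le hB0 hB _ _
  rw [← integral_comp_of_measurePreserving h1 (measurable_signedSup hf fun j => !σ j),
    ← integral_comp_of_measurePreserving h2 (measurable_signedSup hf σ), ← integral_add hi2 hi1]
  refine integral_mono (integrable_of_abs_le (measurable_signedSup (measurable_pairDiff hf) _)
    fun p => abs_signedSup_le hB2 (abs_pairDiff_le hB) _ _) (hi2.add hi1) fun p => ?_
  refine ciSup_le fun i => ?_
  refine le_trans (le_of_eq ?_) (add_le_add
    (le_ciSup (bddAbove_of_abs_le (abs_signed_avg_le hB0 hB _ _)) i)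
    (le_ciSup (bddAbove_of_abs_le (abs_signed_avg_le hB0 hB _ _)) i))
  rw [← mul_add, ← Finset.sum_add_distrib]
  congr 1
  refine Finset.sum_congr rfl fun j _ => ?_
  rw [sgn_not, pairDiff]
  ring

/-- Symmetrization: the mean of the largest deviation is at most twice the mean of the empirical
Rademacher complexity. -/
theorem integral_supDev_le [Countable ι] [Nonempty ι] (ν : Measure E) [IsProbabilityMeasure ν]
    (hf : ∀ i, Measurable (f i)) (hB0 : 0 ≤ B) (hB : ∀ i x, |f i x| ≤ B) (hn : 0 < n) :
    ∫ S, supDev ν f S ∂(Measure.pi fun _ : Fin n => ν) ≤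
      2 * ∫ S, rad f S ∂(Measure.pi fun _ : Fin n => ν) := by
  have hB2 : 0 ≤ 2 * B := by positivity
  set P : Measure (Fin n → E) := Measure.pi fun _ => ν with hP
  have he := measurePreserving_arrowProdEquivProdArrow E E (Fin n) (fun _ => ν) (fun _ => ν)
  have hpair : Measurable fun q : (Fin n → E) × (Fin n → E) => fun j => (q.1 j, q.2 j) :=
    measurable_pi_iff.2 fun j => ((measurable_pi_apply j).comp measurable_fst).prodMk
      ((measurable_pi_apply j).comp measurable_snd)
  have hGm := (measurable_signedSup (n := n) (measurable_pairDiff hf) (fun _ => true)).comp hpair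
  have hGi : Integrable (fun q : (Fin n → E) × (Fin n → E) =>
      signedSup (pairDiff f) (fun _ => true) fun j => (q.1 j, q.2 j)) (P.prod P) :=
    integrable_of_abs_le hGm fun q => abs_signedSup_le hB2 (abs_pairDiff_le hB) _ _
  have hdouble : ∫ S, supDev ν f S ∂P ≤
      ∫ p, signedSup (pairDiff f) (fun _ => true) p ∂(Measure.pi fun _ : Fin n => ν.prod ν) := by
    calc ∫ S, supDev ν f S ∂P
        ≤ ∫ S, ∫ S', signedSup (pairDiff f) (fun _ => true) (fun j => (S j, S' j)) ∂P ∂P :=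
          integral_mono (integrable_of_abs_le (measurable_supDev ν hf) fun S =>
            abs_iSup_le (abs_dev_le ν hB0 hB S)) hGi.integral_prod_left
            (supDev_le_integral ν hf hB0 hB hn)
      _ = ∫ q, signedSup (pairDiff f) (fun _ => true) (fun j => (q.1 j, q.2 j)) ∂(P.prod P) :=
          (integral_prod _ hGi).symm
      _ = _ := (integral_comp_of_measurePreserving he hGm).symm
  -- The bound holds for each fixed pattern. Averaging over all 2ⁿ patterns turns both terms on the
  -- right into the mean complexity, as σ ↦ −σ is a bijection.
  have hσ : ∀ σ : Fin n → Bool, ∫ S, supDev ν f S ∂P ≤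
      ∫ S, signedSup f σ S ∂P + ∫ S, signedSup f (fun j => !σ j) S ∂P := fun σ =>
    hdouble.trans ((integral_signedSup_pairDiff_eq ν hf σ).le.trans
      (integral_signedSup_pairDiff_le ν hf hB0 hB σ))
  have hrad : ∫ S, rad f S ∂P = (1 / (2 : ℝ) ^ n) * ∑ σ, ∫ S, signedSup f σ S ∂P := by
    unfold rad
    rw [integral_const_mul, integral_finsetSum]
    exact fun σ _ => integrable_of_abs_le (measurable_signedSup hf σ)
      fun S => abs_signedSup_le hB0 hB _ _
  have hflip : ∑ σ : Fin n → Bool, ∫ S, signedSup f (fun j => !σ j) S ∂P =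
      ∑ σ : Fin n → Bool, ∫ S, signedSup f σ S ∂P :=
    Fintype.sum_equiv (Equiv.piCongrRight fun _ : Fin n => Equiv.boolNot) _ _ fun σ => rfl
  have hsum := Finset.sum_le_sum fun σ (_ : σ ∈ (Finset.univ : Finset (Fin n → Bool))) => hσ σ
  rw [Finset.sum_add_distrib, hflip] at hsum
  simp only [Finset.sum_const, Finset.card_univ, Fintype.card_pi, Fintype.card_bool,
    Finset.prod_const, Fintype.card_fin, nsmul_eq_mul, Nat.cast_pow, Nat.cast_ofNat] at hsum
  rw [hrad]
  have h2 : (0 : ℝ) < 2 ^ n := by positivity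
  rw [one_div, ← mul_assoc, mul_comm 2, mul_assoc, inv_mul_eq_div, le_div_iff₀ h2]
  linarith

end Symmetrization

/-! ### Uniform deviation bounds with the empirical complexity -/

section UniformDeviation

variable {E : Type*} [MeasurableSpace E] {B η : ℝ} {n : ℕ}

/-- Chebyshev is applied to the difference `supDev - 2 * rad`, whose mean is nonpositive by
symmetrization. The empirical complexity then enters directly, with no separate passage from its
expectation. -/
theorem measure_supDev_gt_le {ι : Type*} [Countable ι] [Nonempty ι] {f : ι → E → ℝ}
    (ν : Measure E) [IsProbabilityMeasure ν]
    (hf : ∀ i, Measurable (f i)) (hB0 : 0 < B) (hB : ∀ i x, |f i x| ≤ B) (hn : 0 < n)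
    (hη : 0 < η) :
    (Measure.pi fun _ : Fin n => ν) {S | 2 * rad f S + 6 * B / Real.sqrt η * (1 / Real.sqrt n)
      < supDev ν f S} ≤ ENNReal.ofReal η := by
  have hn' : (0 : ℝ) < n := by exact_mod_cast hn
  have hdm := measurable_supDev (n := n) ν hf
  have hrm := measurable_rad (n := n) hf
  have hdB : ∀ S : Fin n → E, |supDev ν f S| ≤ 2 * B := fun S =>
    abs_iSup_le (abs_dev_le ν hB0.le hB S)
  have hrB : ∀ S : Fin n → E, |rad f S| ≤ B := abs_rad_le hB0.le hB
  -- The deviation contributes 2B/n and the doubled complexity 4B/n.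
  have hdiff : BoundedDiff (fun S : Fin n → E => supDev ν f S - 2 * rad f S) (6 * B / n) :=
    fun S k x => by
      have h1 := boundedDiff_supDev ν hB0.le hB S k x
      have h2 := boundedDiff_rad hB0.le hB S k x
      have h3 : 6 * B / (n : ℝ) = 2 * B / n + 2 * (2 * B / n) := by ring
      rw [h3]
      rw [abs_le] at h1 h2 ⊢
      constructor <;> linarith [h1.1, h1.2, h2.1, h2.2]
  have hmean : ∫ S, (supDev ν f S - 2 * rad f S) ∂(Measure.pi fun _ : Fin n => ν) ≤ 0 := by
    rw [integral_sub (integrable_of_abs_le hdm hdB)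
      ((integrable_of_abs_le hrm hrB).const_mul 2), integral_const_mul]
    linarith [integral_supDev_le (n := n) ν hf hB0.le hB hn]
  refine le_trans (measure_mono fun S hS => ?_) (measure_gt_le_of_boundedDiff ν
    (hdm.sub (hrm.const_mul 2)) (B := 4 * B) (fun S => ?_) hdiff hmean hn (by positivity) hη)
  · simp only [Set.mem_ofPred_eq, Pi.sub_apply] at hS ⊢
    have : 6 * B / (n : ℝ) * Real.sqrt n / Real.sqrt η
        = 6 * B / Real.sqrt η * (1 / Real.sqrt n) := by
      have h1 : Real.sqrt n ≠ 0 := by positivity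
      have h2 : (n : ℝ) = Real.sqrt n * Real.sqrt n := (Real.mul_self_sqrt hn'.le).symm
      have h3 : Real.sqrt η ≠ 0 := by positivity
      rw [h2, Real.sqrt_mul_self (Real.sqrt_nonneg _)]
      field_simp
    rw [this]
    linarith
  · have h1 := hdB S
    have h2 := hrB S
    rw [abs_le] at h1 h2 ⊢
    simp only [Pi.sub_apply]
    constructor <;> linarith [h1.1, h1.2, h2.1, h2.2]

/-- The lower tail for f is the upper tail for −f, which has the same complexity; hence the doubled
probability. -/
theorem measure_abs_dev_gt_le {ι : Type*} [Countable ι] [Nonempty ι] {f : ι → E → ℝ}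
    (ν : Measure E) [IsProbabilityMeasure ν]
    (hf : ∀ i, Measurable (f i)) (hB0 : 0 < B) (hB : ∀ i x, |f i x| ≤ B) (hn : 0 < n)
    (hη : 0 < η) :
    (Measure.pi fun _ : Fin n => ν) {S | ∃ i,
      2 * rad f S + 6 * B / Real.sqrt η * (1 / Real.sqrt n)
        < |∫ x, f i x ∂ν - (1 / (n : ℝ)) * ∑ j, f i (S j)|} ≤ ENNReal.ofReal (2 * η) := by
  have hB' : ∀ i x, |-f i x| ≤ B := fun i x => by rw [abs_neg]; exact hB i x
  have h1 := measure_supDev_gt_le ν hf hB0 hB hn hη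
  have h2 := measure_supDev_gt_le ν (f := fun i x => -f i x) (fun i => (hf i).neg) hB0 hB' hn hη
  rw [two_mul, ENNReal.ofReal_add hη.le hη.le]
  refine le_trans (measure_mono ?_) ((measure_union_le _ _).trans (add_le_add h1 h2))
  rintro S ⟨i, hi⟩
  rw [lt_abs] at hi
  refine hi.imp (fun h => ?_) fun h => ?_
  · exact h.trans_le (le_ciSup (bddAbove_of_abs_le (abs_dev_le ν hB0.le hB S)) i)
  · rw [Set.mem_ofPred_eq, rad_neg]
    refine h.trans_le (le_trans (le_of_eq ?_)
      (le_ciSup (bddAbove_of_abs_le (abs_dev_le ν hB0.le hB' S)) i))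
    rw [integral_neg, Finset.sum_neg_distrib]
    ring

/-- Uniform deviation bound: for a bounded class with a continuous parametrization, the means and
the empirical averages differ by at most twice the empirical Rademacher complexity and a term of
order `1/√n`, except on an event of small probability. -/
theorem measure_uniform_deviation_le {Ω' T : Type*} [MeasurableSpace Ω'] [TopologicalSpace T]
    [SecondCountableTopology T] [Nonempty T] {f : T → E → ℝ} {ν : Measure E}
    [IsProbabilityMeasure ν] {Q : Measure Ω'} [IsProbabilityMeasure Q] {S : Fin n → Ω' → E}
    (hS : IsIIDSample Q ν S) (hf : ∀ t, Measurable (f t)) (hcont : ∀ x, Continuous fun t => f t x)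
    (hB0 : 0 < B) (hB : ∀ t x, |f t x| ≤ B) (hn : 0 < n) (hη : 0 < η) :
    Q {ω | ∃ t, 2 * rad f (fun j => S j ω) + 6 * B / Real.sqrt η * (1 / Real.sqrt n)
        < |∫ x, f t x ∂ν - (1 / (n : ℝ)) * ∑ j, f t (S j ω)|} ≤ ENNReal.ofReal (2 * η) := by
  obtain ⟨hSm, hSi, hSl⟩ := hS
  set d : ℕ → T := TopologicalSpace.denseSeq T
  have hmap : Q.map (fun ω j => S j ω) = Measure.pi fun _ : Fin n => ν := by
    rw [(iIndepFun_iff_map_fun_eq_pi_map fun j => (hSm j).aemeasurable).1 hSi]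
    congr
    exact funext hSl
  have hSmeas : Measurable fun ω j => S j ω := measurable_pi_iff.2 hSm
  have hmain := measure_abs_dev_gt_le (n := n) ν (f := fun k => f (d k)) (fun k => hf _) hB0
    (fun k => hB _) hn hη
  rw [← hmap] at hmain
  -- `Measure.le_map_apply` holds for arbitrary sets, so the event quantified over all parameters
  -- need not be measurable.
  refine le_trans (le_trans (measure_mono ?_)
    (Measure.le_map_apply hSmeas.aemeasurable _)) hmain
  rintro ω ⟨t, ht⟩
  have hcdev : Continuous fun t => |∫ x, f t x ∂ν - (1 / (n : ℝ)) * ∑ j, f t (S j ω)| := by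
    refine (Continuous.sub ?_ ?_).abs
    · exact continuous_of_dominated (bound := fun _ => B)
        (fun t => (hf t).aestronglyMeasurable)
        (fun t => Filter.Eventually.of_forall (hB t)) (integrable_const _)
        (Filter.Eventually.of_forall hcont)
    · exact continuous_const.mul (continuous_finsetSum _ fun j _ => hcont _)
  -- For fixed ω the threshold does not depend on t, so the violating parameters form an open set,
  -- which meets the dense sequence. Passing to the sequence only lowers the complexity.
  obtain ⟨k, hk⟩ := (TopologicalSpace.denseRange_denseSeq T).exists_mem_open
    (isOpen_lt continuous_const hcdev) ⟨t, ht⟩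
  refine ⟨k, lt_of_le_of_lt ?_ hk⟩
  have : rad (fun k => f (d k)) (fun j => S j ω) ≤ rad f fun j => S j ω := by
    refine mul_le_mul_of_nonneg_left (Finset.sum_le_sum fun σ _ => ?_) (by positivity)
    exact ciSup_le fun k => le_ciSup (bddAbove_of_abs_le (abs_signed_avg_le hB0.le hB σ _)) (d k)
  linarith

end UniformDeviation

/-! ### Conditional independence in terms of conditional laws -/

section ConditionalIndependence

variable {Ω β β' γ : Type*} [MeasurableSpace Ω] [StandardBorelSpace Ω] [MeasurableSpace β]
  [StandardBorelSpace β] [Nonempty β] [MeasurableSpace β'] [mγ : MeasurableSpace γ]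

/-- If `g ⟂ f | k` then the conditional law of `f` given `(k, g)` is that given `k`. No assumption
is made on the space in which `g` takes its values. -/
theorem condDistrib_prodMk_ae_eq_of_condIndepFun {μ : Measure Ω} [IsFiniteMeasure μ] {f : Ω → β}
    {g : Ω → β'} {k : Ω → γ} (hf : Measurable f) (hg : Measurable g) (hk : Measurable k)
    (h : CondIndepFun (MeasurableSpace.comap k mγ) hk.comap_le g f μ) :
    condDistrib f (fun ω => (k ω, g ω)) μ =ᵐ[μ.map fun ω => (k ω, g ω)]
      (condDistrib f k μ).prodMkRight β' := by
  rw [condDistrib_ae_eq_iff_measure_eq_compProd _ hf.aemeasurable]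
  refine Measure.ext_prod₃_iff'.2 fun {s t u} hs ht hu => ?_
  -- On a rectangle, g matters only through the indicator of t. This real-valued function replaces
  -- g, so nothing is required of the space of g.
  have hφ : Measurable (t.indicator (1 : β' → ℝ)) := measurable_one.indicator ht
  have hφg := hφ.comp hg
  have hpre : t.indicator (1 : β' → ℝ) ⁻¹' {1} = t := by
    ext y
    by_cases hy : y ∈ t <;> simp [hy]
  have h' : CondIndepFun (MeasurableSpace.comap k mγ) hk.comap_le
      (t.indicator (1 : β' → ℝ) ∘ g) f μ := h.comp hφ measurable_id
  rw [condIndepFun_iff_condDistrib_prod_ae_eq_prodMkRight hf hφg hk,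
    condDistrib_ae_eq_iff_measure_eq_compProd _ hf.aemeasurable] at h'
  have h1 : MeasurableSet ({1} : Set ℝ) := measurableSet_singleton 1
  have h2 := congrArg (fun m => m ((s ×ˢ {1}) ×ˢ u)) h'
  rw [Measure.map_apply ((hk.prodMk hφg).prodMk hf) ((hs.prod h1).prod hu),
    Measure.compProd_apply_prod (hs.prod h1) hu, setLIntegral_map (hs.prod h1)
      (Kernel.measurable_coe _ hu) (hk.prodMk hφg)] at h2
  rw [Measure.map_apply ((hk.prodMk hg).prodMk hf) ((hs.prod ht).prod hu),
    Measure.compProd_apply_prod (hs.prod ht) hu, setLIntegral_map (hs.prod ht)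
      (Kernel.measurable_coe _ hu) (hk.prodMk hg)]
  have hset : (fun ω => (k ω, (t.indicator (1 : β' → ℝ) ∘ g) ω)) ⁻¹' (s ×ˢ {1}) =
      (fun ω => (k ω, g ω)) ⁻¹' (s ×ˢ t) := by
    rw [Set.mk_preimage_prod, Set.mk_preimage_prod, Set.preimage_comp, hpre]
  rw [Set.mk_preimage_prod, hset] at h2
  rw [Set.mk_preimage_prod, h2]
  rfl

end ConditionalIndependence

/-! ### Root mean squares and change of measure -/

section RootMeanSquare

variable {α : Type*} [MeasurableSpace α] {μ : Measure α}

/-- The root mean square of `f`. -/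
noncomputable def rms (μ : Measure α) (f : α → ℝ) : ℝ := Real.sqrt (∫ x, f x ^ 2 ∂μ)

theorem rms_nonneg (f : α → ℝ) : 0 ≤ rms μ f := Real.sqrt_nonneg _

theorem eLpNorm_two_eq_rms {f : α → ℝ} (hf : MemLp f 2 μ) :
    eLpNorm f 2 μ = ENNReal.ofReal (rms μ f) := by
  rw [hf.eLpNorm_eq_integral_rpow_norm two_ne_zero ENNReal.ofNat_ne_top]
  congr 1
  rw [rms, Real.sqrt_eq_rpow]
  simp

theorem rms_add_le {f g : α → ℝ} (hf : MemLp f 2 μ) (hg : MemLp g 2 μ) :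
    rms μ (fun x => f x + g x) ≤ rms μ f + rms μ g := by
  have h := eLpNorm_add_le hf.1 hg.1 (p := 2) one_le_two
  rw [eLpNorm_two_eq_rms hf, eLpNorm_two_eq_rms hg, eLpNorm_two_eq_rms (hf.add hg),
    ← ENNReal.ofReal_add (rms_nonneg _) (rms_nonneg _)] at h
  exact (ENNReal.ofReal_le_ofReal_iff (add_nonneg (rms_nonneg _) (rms_nonneg _))).1 h

theorem rms_congr {f g : α → ℝ} (h : f =ᵐ[μ] g) : rms μ f = rms μ g := by
  unfold rms
  congr 1
  refine integral_congr_ae ?_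
  filter_upwards [h] with x hx
  rw [hx]

/-- A change of measure with a square-integrable density. -/
theorem lintegral_enorm_le_of_density {ν₁ ν₂ : Measure α} [IsFiniteMeasure ν₁] [IsFiniteMeasure ν₂]
    (hac : ν₁ ≪ ν₂) {ρ : ℝ≥0} (hρ : ∫⁻ x, (ν₁.rnDeriv ν₂ x) ^ 2 ∂ν₂ ≤ (ρ : ℝ≥0∞) ^ 2)
    {g : α → ℝ} (hg : Measurable g) : ∫⁻ x, ‖g x‖ₑ ∂ν₁ ≤ ρ * eLpNorm g 2 ν₂ := by
  rw [← lintegral_rnDeriv_mul hac hg.enorm.aemeasurable]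
  refine (ENNReal.lintegral_mul_le_Lp_mul_Lq ν₂ Real.HolderConjugate.two_two
    (Measure.measurable_rnDeriv _ _).aemeasurable hg.enorm.aemeasurable).trans ?_
  rw [eLpNorm_eq_lintegral_rpow_enorm_toReal two_ne_zero ENNReal.ofNat_ne_top]
  simp only [ENNReal.toReal_ofNat]
  gcongr
  calc (∫⁻ x, ν₁.rnDeriv ν₂ x ^ (2 : ℝ) ∂ν₂) ^ (1 / 2 : ℝ)
      ≤ ((ρ : ℝ≥0∞) ^ (2 : ℝ)) ^ (1 / 2 : ℝ) := by
        gcongr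
        simpa using hρ
    _ = ρ := by
        rw [← ENNReal.rpow_mul]
        norm_num

end RootMeanSquare

/-! ### Identification of the policy value by a bridge function -/

namespace Population

variable {Ω 𝒰 𝒜 𝒵 𝒲 𝒞 : Type*} [MeasurableSpace Ω] [MeasurableSpace 𝒰] [MeasurableSpace 𝒜]
  [MeasurableSpace 𝒵] [MeasurableSpace 𝒲] [MeasurableSpace 𝒞] {P : Population Ω 𝒰 𝒜 𝒵 𝒲 𝒞}
  {h : 𝒜 × 𝒲 → ℝ} {M : ℝ}

theorem measurable_outcomeMean : Measurable P.outcomeMean :=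
  (measurable_snd.stronglyMeasurable.integral_condDistrib (Y := P.Y)
    (X := fun ω => (P.A ω, P.U ω)) (μ := P.μ)).measurable

theorem memLp_Y (hY : ∀ᵐ ω ∂P.μ, |P.Y ω| ≤ M) : MemLp P.Y 2 P.μ :=
  MemLp.of_bound P.measurable_Y.aestronglyMeasurable M hY

theorem sigmaAZ_le : P.sigmaAZ ≤ ‹MeasurableSpace Ω› :=
  (P.measurable_A.prodMk P.measurable_Z).comap_le

/-- Cauchy–Schwarz against the density of (π(C), W): square-integrability under (A, W) yields
integrability under the policy, at the cost of ρ. -/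
theorem integrable_policy {π : 𝒞 → 𝒜} {ρ : ℝ≥0} {g : 𝒜 × 𝒲 → ℝ} (hπ : Measurable π)
    (hρ : P.PolicyL2 π ρ) (hg : Measurable g) (hL : MemLp (fun ω => g (P.A ω, P.W ω)) 2 P.μ) :
    Integrable (fun ω => g (π (P.C ω), P.W ω)) P.μ ∧
      |∫ ω, g (π (P.C ω), P.W ω) ∂P.μ| ≤ ρ * rms P.μ fun ω => g (P.A ω, P.W ω) := by
  have hm1 : Measurable fun ω => (π (P.C ω), P.W ω) :=
    (hπ.comp P.measurable_C).prodMk P.measurable_W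
  have hm2 := P.measurable_A.prodMk P.measurable_W
  have hb := lintegral_enorm_le_of_density hρ.1 hρ.2 hg
  rw [lintegral_map hg.enorm hm1, eLpNorm_map_measure hg.aestronglyMeasurable hm2.aemeasurable,
    eLpNorm_two_eq_rms (f := g ∘ fun ω => (P.A ω, P.W ω)) hL] at hb
  have hfin : ∫⁻ ω, ‖g (π (P.C ω), P.W ω)‖ₑ ∂P.μ < ∞ :=
    hb.trans_lt (ENNReal.mul_lt_top ENNReal.coe_lt_top ENNReal.ofReal_lt_top)
  have hint : Integrable (fun ω => g (π (P.C ω), P.W ω)) P.μ :=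
    ⟨(hg.comp hm1).aestronglyMeasurable, hfin⟩
  refine ⟨hint, ?_⟩
  have h3 := enorm_integral_le_lintegral_enorm (μ := P.μ) fun ω => g (π (P.C ω), P.W ω)
  have h4 := ENNReal.toReal_mono (ENNReal.mul_lt_top ENNReal.coe_lt_top ENNReal.ofReal_lt_top).ne
    (h3.trans hb)
  rw [toReal_enorm, ENNReal.toReal_mul, ENNReal.toReal_ofReal (rms_nonneg _)] at h4
  exact h4

/-- Y ⟂ Z | (A, U) removes Z from the conditional law of Y. -/
theorem condExp_Y_ae_eq [StandardBorelSpace Ω] (hS : P.Structural) (hY : ∀ᵐ ω ∂P.μ, |P.Y ω| ≤ M) :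
    P.μ[P.Y | MeasurableSpace.comap (fun ω => ((P.A ω, P.U ω), P.Z ω)) inferInstance] =ᵐ[P.μ]
      fun ω => P.outcomeMean (P.A ω, P.U ω) := by
  have hAU := P.measurable_A.prodMk P.measurable_U
  have hX := hAU.prodMk P.measurable_Z
  refine (condExp_ae_eq_integral_condDistrib' hX ((memLp_Y hY).integrable one_le_two)).trans ?_
  filter_upwards [ae_of_ae_map hX.aemeasurable (condDistrib_prodMk_ae_eq_of_condIndepFun
    P.measurable_Y P.measurable_Z hAU hS.1.symm)] with ω hω
  rw [hω]
  rfl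

variable [StandardBorelSpace 𝒲] [Nonempty 𝒲]

/-- The function `(a, u) ↦ E[h(a, W) | U = u]`. -/
noncomputable def bridgeMean (P : Population Ω 𝒰 𝒜 𝒵 𝒲 𝒞) (h : 𝒜 × 𝒲 → ℝ) (x : 𝒜 × 𝒰) : ℝ :=
  ∫ w, h (x.1, w) ∂(condDistrib P.W P.U P.μ x.2)

theorem measurable_bridgeMean (hh : Measurable h) : Measurable (P.bridgeMean h) := by
  have : StronglyMeasurable fun p : (𝒜 × 𝒰) × 𝒲 => h (p.1.1, p.2) :=
    (hh.comp ((measurable_fst.comp measurable_fst).prodMk measurable_snd)).stronglyMeasurable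
  exact (this.integral_kernel_prod_right'
    (κ := (condDistrib P.W P.U P.μ).prodMkLeft 𝒜)).measurable

variable [StandardBorelSpace Ω]

/-- W ⟂ (A, Z) | U: given (U, A, Z), the first argument of h is frozen at A and W still has its law
given U. -/
theorem condExp_bridge_ae_eq (hS : P.Structural) (hh : Measurable h)
    (hL : MemLp (fun ω => h (P.A ω, P.W ω)) 2 P.μ) :
    P.μ[fun ω => h (P.A ω, P.W ω) |
        MeasurableSpace.comap (fun ω => (P.U ω, (P.A ω, P.Z ω))) inferInstance] =ᵐ[P.μ]
      fun ω => P.bridgeMean h (P.A ω, P.U ω) := by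
  have hAZ := P.measurable_A.prodMk P.measurable_Z
  have hX := P.measurable_U.prodMk hAZ
  have hf : StronglyMeasurable fun p : (𝒰 × 𝒜 × 𝒵) × 𝒲 => h (p.1.2.1, p.2) :=
    (hh.comp ((measurable_fst.comp (measurable_snd.comp measurable_fst)).prodMk
      measurable_snd)).stronglyMeasurable
  refine (condExp_prod_ae_eq_integral_condDistrib hX P.measurable_W.aemeasurable hf
    (hL.integrable one_le_two)).trans ?_
  filter_upwards [ae_of_ae_map hX.aemeasurable (condDistrib_prodMk_ae_eq_of_condIndepFun
    P.measurable_W hAZ P.measurable_U hS.2.symm)] with ω hω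
  rw [hω]
  rfl

/-- The outcome and the bridge function have the same conditional mean given the confounder. -/
theorem outcomeMean_ae_eq_bridgeMean (hS : P.Structural) (hC : P.ConfounderComplete)
    (hB : P.IsBridge h) (hY : ∀ᵐ ω ∂P.μ, |P.Y ω| ≤ M) :
    (fun ω => P.outcomeMean (P.A ω, P.U ω) - P.bridgeMean h (P.A ω, P.U ω)) =ᵐ[P.μ] 0 := by
  obtain ⟨hh, hL, heq⟩ := hB
  have hAU := P.measurable_A.prodMk P.measurable_U
  have hm1 := (hAU.prodMk P.measurable_Z).comap_le
  have hm2 := (P.measurable_U.prodMk (P.measurable_A.prodMk P.measurable_Z)).comap_le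
  have h1 := condExp_Y_ae_eq hS hY
  have h2 := condExp_bridge_ae_eq hS hh hL
  have hL1 : MemLp (fun ω => P.outcomeMean (P.A ω, P.U ω)) 2 P.μ :=
    (memLp_congr_ae h1).1 ((memLp_Y hY).condExp one_le_two)
  have hL2 : MemLp (fun ω => P.bridgeMean h (P.A ω, P.U ω)) 2 P.μ :=
    (memLp_congr_ae h2).1 (hL.condExp one_le_two)
  have hle1 : P.sigmaAZ ≤
      MeasurableSpace.comap (fun ω => ((P.A ω, P.U ω), P.Z ω)) inferInstance :=
    measurable_iff_comap_le.1 (((measurable_fst.comp measurable_fst).prodMk measurable_snd).comp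
      (comap_measurable fun ω => ((P.A ω, P.U ω), P.Z ω)))
  have hle2 : P.sigmaAZ ≤
      MeasurableSpace.comap (fun ω => (P.U ω, (P.A ω, P.Z ω))) inferInstance :=
    measurable_iff_comap_le.1 (measurable_snd.comp
      (comap_measurable fun ω => (P.U ω, (P.A ω, P.Z ω))))
  -- By the tower property the two means project on (A, Z) like Y and h(A, W), whose projections
  -- agree by the bridge equation. Completeness then annihilates the difference.
  refine (hC (fun x => P.outcomeMean x - P.bridgeMean h x)
    (measurable_outcomeMean.sub (measurable_bridgeMean hh)) (hL1.sub hL2)).1 ?_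
  have e1 : P.μ[fun ω => P.outcomeMean (P.A ω, P.U ω) | P.sigmaAZ] =ᵐ[P.μ]
      P.μ[P.Y | P.sigmaAZ] :=
    (condExp_congr_ae h1.symm).trans (condExp_condExp_of_le hle1 hm1)
  have e2 : P.μ[fun ω => P.bridgeMean h (P.A ω, P.U ω) | P.sigmaAZ] =ᵐ[P.μ]
      P.μ[fun ω => h (P.A ω, P.W ω) | P.sigmaAZ] :=
    (condExp_congr_ae h2.symm).trans (condExp_condExp_of_le hle2 hm2)
  refine (condExp_sub (hL1.integrable one_le_two) (hL2.integrable one_le_two) _).trans ?_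
  filter_upwards [e1, e2, heq] with ω w1 w2 w3
  simp [w1, w2, w3]

/-- Identification: the value of a policy is the mean of the bridge function under the policy. -/
theorem value_eq_integral_bridge {π : 𝒞 → 𝒜} {ρ : ℝ≥0} (hS : P.Structural)
    (hI : P.PolicyVariableIndep) (hC : P.ConfounderComplete) (hB : P.IsBridge h)
    (hY : ∀ᵐ ω ∂P.μ, |P.Y ω| ≤ M) (hπ : Measurable π) (hO : P.Overlap π) (hρ : P.PolicyL2 π ρ) :
    P.value π = ∫ ω, h (π (P.C ω), P.W ω) ∂P.μ := by
  have hpU : Measurable fun ω => (π (P.C ω), P.U ω) :=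
    (hπ.comp P.measurable_C).prodMk P.measurable_U
  have hAU := P.measurable_A.prodMk P.measurable_U
  have hX := P.measurable_U.prodMk P.measurable_C
  have hmeas : MeasurableSet {x | P.outcomeMean x - P.bridgeMean h x = 0} :=
    (measurable_outcomeMean.sub (measurable_bridgeMean hB.1)) (measurableSet_singleton 0)
  have h0 : ∀ᵐ x ∂(P.μ.map fun ω => (P.A ω, P.U ω)), P.outcomeMean x - P.bridgeMean h x = 0 :=
    (ae_map_iff hAU.aemeasurable hmeas).2 (outcomeMean_ae_eq_bridgeMean hS hC hB hY)
  -- Overlap transports the null set from the law of (A, U) to that of (π(C), U).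
  have h1 := ae_of_ae_map hpU.aemeasurable (hO.ae_le h0)
  have hf : StronglyMeasurable fun p : (𝒰 × 𝒞) × 𝒲 => h (π p.1.2, p.2) :=
    (hB.1.comp ((hπ.comp (measurable_snd.comp measurable_fst)).prodMk
      measurable_snd)).stronglyMeasurable
  have h2 := condExp_prod_ae_eq_integral_condDistrib (μ := P.μ) hX P.measurable_W.aemeasurable hf
    (integrable_policy hπ hρ hB.1 hB.2.1).1
  have h3 := ae_of_ae_map hX.aemeasurable (condDistrib_prodMk_ae_eq_of_condIndepFun
    P.measurable_W P.measurable_C P.measurable_U hI)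
  rw [value, ← integral_condExp hX.comap_le (f := fun ω => h (π (P.C ω), P.W ω))]
  refine integral_congr_ae ?_
  filter_upwards [h1, h2, h3] with ω w1 w2 w3
  rw [w2, w3, sub_eq_zero.1 w1]
  rfl

/-- Identification makes the error a policy mean of h − g. The density costs ρ, inverting the
conditional expectation costs τ, and the bridge equation replaces E[h | A, Z] by E[Y | A, Z]. -/
theorem abs_value_sub_le {π : 𝒞 → 𝒜} {ρ τ : ℝ≥0} {g : 𝒜 × 𝒲 → ℝ} (hS : P.Structural)
    (hI : P.PolicyVariableIndep) (hC : P.ConfounderComplete) (hB : P.IsBridge h)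
    (hY : ∀ᵐ ω ∂P.μ, |P.Y ω| ≤ M) (hπ : Measurable π) (hO : P.Overlap π) (hρ : P.PolicyL2 π ρ)
    (hg : Measurable g) (hL : MemLp (fun ω => g (P.A ω, P.W ω)) 2 P.μ)
    (hτ : eLpNorm (fun ω => h (P.A ω, P.W ω) - g (P.A ω, P.W ω)) 2 P.μ /
      eLpNorm (P.μ[fun ω => h (P.A ω, P.W ω) - g (P.A ω, P.W ω) | P.sigmaAZ]) 2 P.μ ≤ τ) :
    |P.value π - ∫ ω, g (π (P.C ω), P.W ω) ∂P.μ| ≤ ρ * (τ * rms P.μ fun ω =>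
      (P.μ[P.Y | P.sigmaAZ]) ω - (P.μ[fun ω' => g (P.A ω', P.W ω') | P.sigmaAZ]) ω) := by
  have hd : MemLp (fun ω => h (P.A ω, P.W ω) - g (P.A ω, P.W ω)) 2 P.μ := hB.2.1.sub hL
  have hc := hd.condExp (m := P.sigmaAZ) one_le_two
  have hp1 := integrable_policy hπ hρ hB.1 hB.2.1
  have hp2 := integrable_policy hπ hρ hg hL
  have hp3 := (integrable_policy hπ hρ (hB.1.sub hg) hd).2
  rw [value_eq_integral_bridge hS hI hC hB hY hπ hO hρ, ← integral_sub hp1.1 hp2.1]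
  refine hp3.trans (mul_le_mul_of_nonneg_left ?_ ρ.2)
  rw [ENNReal.div_le_iff_le_mul (Or.inr ENNReal.coe_ne_top) (Or.inl hc.2.ne),
    eLpNorm_two_eq_rms hd, eLpNorm_two_eq_rms hc] at hτ
  have h4 := ENNReal.toReal_mono (ENNReal.mul_lt_top ENNReal.coe_lt_top ENNReal.ofReal_lt_top).ne hτ
  rw [ENNReal.toReal_mul, ENNReal.toReal_ofReal (rms_nonneg _),
    ENNReal.toReal_ofReal (rms_nonneg _)] at h4
  refine h4.trans (mul_le_mul_of_nonneg_left (le_of_eq (rms_congr ?_)) τ.2)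
  filter_upwards [condExp_sub (hB.2.1.integrable one_le_two) (hL.integrable one_le_two) P.sigmaAZ,
    hB.2.2] with ω w1 w2
  rw [w2]
  exact w1

end Population

/-! ### Bias-variance decomposition -/

section Pythagoras

variable {Ω : Type*} {m m0 : MeasurableSpace Ω} {μ : Measure Ω} [IsProbabilityMeasure μ]

/-- The bias-variance decomposition of the mean squared error of an `m`-measurable prediction. -/
theorem integral_sq_sub_eq (hm : m ≤ m0) {X g : Ω → ℝ} (hX : MemLp X 2 μ) (hg : MemLp g 2 μ)
    (hgm : StronglyMeasurable[m] g) :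
    ∫ ω, (X ω - g ω) ^ 2 ∂μ =
      ∫ ω, ((μ[X | m]) ω - g ω) ^ 2 ∂μ + ∫ ω, (X ω - (μ[X | m]) ω) ^ 2 ∂μ := by
  set e := μ[X | m]
  have heL : MemLp e 2 μ := hX.condExp one_le_two
  have hXe : MemLp (fun ω => X ω - e ω) 2 μ := hX.sub heL
  have heg : MemLp (fun ω => e ω - g ω) 2 μ := heL.sub hg
  have hcm : StronglyMeasurable[m] fun ω => e ω - g ω := stronglyMeasurable_condExp.sub hgm
  have hprod : Integrable (fun ω => (X ω - e ω) * (e ω - g ω)) μ := hXe.integrable_mul heg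
  -- The residual X − E[X | m] is orthogonal to square-integrable m-measurable functions, in
  -- particular to E[X | m] − g.
  have hcross : ∫ ω, (X ω - e ω) * (e ω - g ω) ∂μ = 0 := by
    rw [← integral_condExp hm]
    have h1 := condExp_mul_of_stronglyMeasurable_right (μ := μ) hcm hprod
      (hXe.integrable one_le_two)
    have h2 := condExp_sub (hX.integrable one_le_two) (heL.integrable one_le_two) m
    rw [condExp_of_stronglyMeasurable hm stronglyMeasurable_condExp
      (heL.integrable one_le_two)] at h2
    refine (integral_congr_ae (g := fun _ => (0 : ℝ)) ?_).trans (by simp)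
    filter_upwards [h1, h2] with ω w1 w2
    refine w1.trans ?_
    rw [Pi.mul_apply]
    have : (μ[fun ω => X ω - e ω | m]) ω = 0 := by
      refine w2.trans ?_
      simp
    rw [this, zero_mul]
  have i1 := hXe.integrable_sq
  have i2 := heg.integrable_sq
  calc ∫ ω, (X ω - g ω) ^ 2 ∂μ
      = ∫ ω, (((e ω - g ω) ^ 2 + (X ω - e ω) ^ 2) + 2 * ((X ω - e ω) * (e ω - g ω))) ∂μ := by
        congr 1
        ext ω
        ring
    _ = _ := by
        rw [integral_add (f := fun ω => (e ω - g ω) ^ 2 + (X ω - e ω) ^ 2) (i2.add i1)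
            (hprod.const_mul 2), integral_add i2 i1, integral_const_mul,
          hcross]
        ring

end Pythagoras

/-! ### Elementary bounds for Euclidean norms -/

theorem sqNorm_nonneg {ι : Type*} [Fintype ι] (x : ι → ℝ) : 0 ≤ sqNorm x :=
  Finset.sum_nonneg fun _ _ => sq_nonneg _

theorem sqFrob_nonneg {ι κ : Type*} [Fintype ι] [Fintype κ] (V : Matrix ι κ ℝ) : 0 ≤ sqFrob V :=
  Finset.sum_nonneg fun _ _ => Finset.sum_nonneg fun _ _ => sq_nonneg _

theorem abs_le_of_sqNorm_le {ι : Type*} [Fintype ι] {x : ι → ℝ} {M : ℝ} (h : sqNorm x ≤ M ^ 2)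
    (j : ι) : |x j| ≤ |M| :=
  sq_le_sq.1 ((Finset.single_le_sum (f := fun j => x j ^ 2) (fun _ _ => sq_nonneg _)
    (Finset.mem_univ j)).trans h)

theorem sqNorm_sub_le {ι : Type*} [Fintype ι] (x y : ι → ℝ) :
    sqNorm (x - y) ≤ 2 * sqNorm x + 2 * sqNorm y := by
  unfold sqNorm
  rw [Finset.mul_sum, Finset.mul_sum, ← Finset.sum_add_distrib]
  refine Finset.sum_le_sum fun j _ => ?_
  rw [Pi.sub_apply]
  nlinarith [sq_nonneg (x j + y j)]

theorem sq_sum_mul_le {ι : Type*} [Fintype ι] {c : ι → ℝ} {M : ℝ} (hc : sqNorm c ≤ M ^ 2)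
    (v : ι → ℝ) : (∑ j, c j * v j) ^ 2 ≤ M ^ 2 * sqNorm v :=
  (Finset.sum_mul_sq_le_sq_mul_sq _ _ _).trans
    (mul_le_mul_of_nonneg_right hc (sqNorm_nonneg v))

/-! ### Regularity of the feature model and the two oracle inequalities -/

namespace FeatureModel

variable {𝒜 𝒵 𝒲 : Type*} [MeasurableSpace 𝒜] [MeasurableSpace 𝒵] [MeasurableSpace 𝒲]
  {F : FeatureModel 𝒜 𝒵 𝒲} {M : ℝ}

/-- The vector representing the linear map `v ↦ uᵀ (ψ_{θ_{A(2)}}(a) ⊗ v)`. -/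
noncomputable def coef (F : FeatureModel 𝒜 𝒵 𝒲) (q : F.Par2) (a : 𝒜) (j : Fin F.dψW) : ℝ :=
  ∑ i, q.1 (i, j) * F.ψA q.2 a i

theorem dotProduct_kron_eq (q : F.Par2) (a : 𝒜) (v : Fin F.dψW → ℝ) :
    q.1 ⬝ᵥ kron (F.ψA q.2 a) v = ∑ j, F.coef q a j * v j := by
  unfold coef dotProduct kron
  rw [Fintype.sum_prod_type_right]
  refine Finset.sum_congr rfl fun j _ => ?_
  rw [Finset.sum_mul]
  exact Finset.sum_congr rfl fun i _ => (mul_assoc _ _ _).symm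

theorem pred2_eq (q : F.Par2) (p : F.Par1) (a : 𝒜) (z : 𝒵) :
    F.pred2 q p a z = ∑ j, F.coef q a j * F.pred1 p a z j :=
  dotProduct_kron_eq q a _

theorem bridge_eq (q : F.Par2) (θ : F.ParW) (x : 𝒜 × 𝒲) :
    F.bridge q θ x = ∑ j, F.coef q x.1 j * F.ψW θ x.2 j :=
  dotProduct_kron_eq q x.1 _

theorem measurable_coef (q : F.Par2) (j : Fin F.dψW) : Measurable fun a => F.coef q a j :=
  Finset.measurable_fun_sum _ fun i _ =>
    ((measurable_pi_apply i).comp (F.measurable_ψA q.2)).const_mul _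

theorem measurable_ψW_apply (θ : F.ParW) (j : Fin F.dψW) : Measurable fun w => F.ψW θ w j :=
  (measurable_pi_apply j).comp (F.measurable_ψW θ)

theorem measurable_pred1 (p : F.Par1) (j : Fin F.dψW) :
    Measurable fun x : 𝒜 × 𝒵 => F.pred1 p x.1 x.2 j :=
  Finset.measurable_fun_sum _ fun k _ =>
    ((((measurable_pi_apply k.1).comp (F.measurable_φA p.2.1)).comp measurable_fst).mul
      (((measurable_pi_apply k.2).comp (F.measurable_φZ p.2.2)).comp measurable_snd)).const_mul _

theorem measurable_pred2 (q : F.Par2) (p : F.Par1) :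
    Measurable fun x : 𝒜 × 𝒵 => F.pred2 q p x.1 x.2 := by
  simp_rw [pred2_eq]
  exact Finset.measurable_fun_sum _ fun j _ =>
    ((measurable_coef q j).comp measurable_fst).mul (measurable_pred1 p j)

theorem measurable_bridge (q : F.Par2) (θ : F.ParW) : Measurable (F.bridge q θ) := by
  rw [show F.bridge q θ = _ from funext (bridge_eq q θ)]
  exact Finset.measurable_fun_sum _ fun j _ =>
    ((measurable_coef q j).comp measurable_fst).mul
      ((measurable_ψW_apply θ j).comp measurable_snd)

theorem measurable_loss1 (θ : F.ParW) (p : F.Par1) : Measurable (F.loss1 θ p) := by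
  have h : ∀ j, Measurable fun x : 𝒲 × 𝒜 × 𝒵 => F.ψW θ x.1 j - F.pred1 p x.2.1 x.2.2 j :=
    fun j => ((measurable_ψW_apply θ j).comp measurable_fst).sub
      ((measurable_pred1 p j).comp measurable_snd)
  exact Finset.measurable_fun_sum Finset.univ fun j _ => (h j).pow_const 2

theorem continuous_pred1 (a : 𝒜) (z : 𝒵) (j : Fin F.dψW) :
    Continuous fun p : F.Par1 => F.pred1 p a z j := by
  refine continuous_finsetSum _ fun k _ => Continuous.mul ?_ (Continuous.mul ?_ ?_)
  · exact continuous_fst.matrix_elem j k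
  · exact (continuous_apply k.1).comp ((F.continuous_φA a).comp continuous_snd.fst)
  · exact (continuous_apply k.2).comp ((F.continuous_φZ z).comp continuous_snd.snd)

theorem continuous_coef (a : 𝒜) (j : Fin F.dψW) : Continuous fun q : F.Par2 => F.coef q a j :=
  continuous_finsetSum _ fun i _ => ((continuous_apply (i, j)).comp continuous_fst).mul
    ((continuous_apply i).comp ((F.continuous_ψA a).comp continuous_snd))

theorem continuous_ψW_apply (w : 𝒲) (j : Fin F.dψW) : Continuous fun θ => F.ψW θ w j :=
  (continuous_apply j).comp (F.continuous_ψW w)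

theorem continuous_loss1 (x : 𝒲 × 𝒜 × 𝒵) :
    Continuous fun r : F.ParW × F.Par1 => F.loss1 r.1 r.2 x := by
  have h : ∀ j, Continuous fun r : F.ParW × F.Par1 =>
      F.ψW r.1 x.1 j - F.pred1 r.2 x.2.1 x.2.2 j := fun j =>
    ((continuous_ψW_apply x.1 j).comp continuous_fst).sub
      ((continuous_pred1 x.2.1 x.2.2 j).comp continuous_snd)
  exact continuous_finsetSum Finset.univ fun j _ => (h j).pow 2

theorem continuous_pred2 (a : 𝒜) (z : 𝒵) :
    Continuous fun r : F.Par2 × F.Par1 => F.pred2 r.1 r.2 a z := by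
  simp_rw [pred2_eq]
  exact continuous_finsetSum _ fun j _ => ((continuous_coef a j).comp continuous_fst).mul
    ((continuous_pred1 a z j).comp continuous_snd)

theorem continuous_bridge (x : 𝒜 × 𝒲) :
    Continuous fun r : F.Par2 × F.ParW => F.bridge r.1 r.2 x := by
  simp_rw [bridge_eq]
  exact continuous_finsetSum _ fun j _ => ((continuous_coef x.1 j).comp continuous_fst).mul
    ((continuous_ψW_apply x.2 j).comp continuous_snd)

theorem loss1_nonneg (θ : F.ParW) (p : F.Par1) (x : 𝒲 × 𝒜 × 𝒵) : 0 ≤ F.loss1 θ p x :=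
  sqNorm_nonneg _

theorem abs_loss1_le (hF : F.Bounded M) {θ : F.ParW} (hθ : θ ∈ F.ΘW) {p : F.Par1}
    (hp : p ∈ F.stage1) (x : 𝒲 × 𝒜 × 𝒵) : |F.loss1 θ p x| ≤ 4 := by
  rw [abs_of_nonneg (loss1_nonneg _ _ _)]
  have := sqNorm_sub_le (F.ψW θ x.1) (F.pred1 p x.2.1 x.2.2)
  unfold loss1
  linarith [hF.1 p hp x.2.1 x.2.2, hF.2.1 θ hθ x.1]

theorem abs_ψW_le (hF : F.Bounded M) {θ : F.ParW} (hθ : θ ∈ F.ΘW) (w : 𝒲) (j : Fin F.dψW) :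
    |F.ψW θ w j| ≤ 1 := by
  simpa using abs_le_of_sqNorm_le (M := 1) (by simpa using hF.2.1 θ hθ w) j

theorem abs_pred1_le (hF : F.Bounded M) {p : F.Par1} (hp : p ∈ F.stage1) (a : 𝒜) (z : 𝒵)
    (j : Fin F.dψW) : |F.pred1 p a z j| ≤ 1 := by
  simpa using abs_le_of_sqNorm_le (M := 1) (by simpa using hF.1 p hp a z) j

theorem sqNorm_coef_le (hF : F.Bounded M) {q : F.Par2} (hq : q ∈ F.stage2) (a : 𝒜) :
    sqNorm (F.coef q a) ≤ M ^ 2 :=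
  hF.2.2 q hq a

theorem abs_sum_coef_mul_le (hF : F.Bounded M) {q : F.Par2} (hq : q ∈ F.stage2) (a : 𝒜)
    {v : Fin F.dψW → ℝ} (hv : sqNorm v ≤ 1) : |∑ j, F.coef q a j * v j| ≤ |M| := by
  refine sq_le_sq.1 ((sq_sum_mul_le (sqNorm_coef_le hF hq a) v).trans ?_)
  nlinarith [sq_nonneg M]

theorem abs_pred2_le (hF : F.Bounded M) {q : F.Par2} (hq : q ∈ F.stage2) {p : F.Par1}
    (hp : p ∈ F.stage1) (a : 𝒜) (z : 𝒵) : |F.pred2 q p a z| ≤ |M| := by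
  rw [pred2_eq]
  exact abs_sum_coef_mul_le hF hq a (hF.1 p hp a z)

theorem abs_bridge_le (hF : F.Bounded M) {q : F.Par2} (hq : q ∈ F.stage2) {θ : F.ParW}
    (hθ : θ ∈ F.ΘW) (x : 𝒜 × 𝒲) : |F.bridge q θ x| ≤ |M| := by
  rw [bridge_eq]
  exact abs_sum_coef_mul_le hF hq x.1 (hF.2.1 θ hθ x.2)

variable {Ω 𝒰 𝒞 : Type*} [MeasurableSpace Ω] [MeasurableSpace 𝒰] [MeasurableSpace 𝒞]
  {P : Population Ω 𝒰 𝒜 𝒵 𝒲 𝒞}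

theorem memLp_of_abs_le {f : Ω → ℝ} (hf : Measurable f) {B : ℝ} (hB : ∀ ω, |f ω| ≤ B) :
    MemLp f 2 P.μ :=
  MemLp.of_bound hf.aestronglyMeasurable B (Filter.Eventually.of_forall hB)

theorem stronglyMeasurable_comp_AZ {g : 𝒜 × 𝒵 → ℝ} (hg : Measurable g) :
    StronglyMeasurable[P.sigmaAZ] fun ω => g (P.A ω, P.Z ω) :=
  (hg.comp (comap_measurable fun ω => (P.A ω, P.Z ω))).stronglyMeasurable

/-- The conditional mean of the features of `W`. -/
noncomputable def featMean (F : FeatureModel 𝒜 𝒵 𝒲) (P : Population Ω 𝒰 𝒜 𝒵 𝒲 𝒞) (θ : F.ParW)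
    (j : Fin F.dψW) : Ω → ℝ :=
  P.μ[fun ω => F.ψW θ (P.W ω) j | P.sigmaAZ]

/-- The excess risk of a stage 1 prediction. -/
noncomputable def excess1 (F : FeatureModel 𝒜 𝒵 𝒲) (P : Population Ω 𝒰 𝒜 𝒵 𝒲 𝒞) (θ : F.ParW)
    (p : F.Par1) : ℝ :=
  ∫ ω, ∑ j, (F.featMean P θ j ω - F.pred1 p (P.A ω) (P.Z ω) j) ^ 2 ∂P.μ

theorem memLp_ψW (hF : F.Bounded M) {θ : F.ParW} (hθ : θ ∈ F.ΘW) (j : Fin F.dψW) :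
    MemLp (fun ω => F.ψW θ (P.W ω) j) 2 P.μ :=
  memLp_of_abs_le ((measurable_ψW_apply θ j).comp P.measurable_W) fun _ => abs_ψW_le hF hθ _ j

theorem memLp_featMean (hF : F.Bounded M) {θ : F.ParW} (hθ : θ ∈ F.ΘW) (j : Fin F.dψW) :
    MemLp (F.featMean P θ j) 2 P.μ :=
  (memLp_ψW hF hθ j).condExp one_le_two

theorem memLp_pred1 (hF : F.Bounded M) {p : F.Par1} (hp : p ∈ F.stage1) (j : Fin F.dψW) :
    MemLp (fun ω => F.pred1 p (P.A ω) (P.Z ω) j) 2 P.μ :=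
  memLp_of_abs_le ((measurable_pred1 p j).comp (P.measurable_A.prodMk P.measurable_Z))
    fun _ => abs_pred1_le hF hp _ _ j

theorem memLp_pred2 (hF : F.Bounded M) {q : F.Par2} (hq : q ∈ F.stage2) {p : F.Par1}
    (hp : p ∈ F.stage1) : MemLp (fun ω => F.pred2 q p (P.A ω) (P.Z ω)) 2 P.μ :=
  memLp_of_abs_le ((measurable_pred2 q p).comp (P.measurable_A.prodMk P.measurable_Z))
    fun _ => abs_pred2_le hF hq hp _ _

theorem memLp_bridge (hF : F.Bounded M) {q : F.Par2} (hq : q ∈ F.stage2) {θ : F.ParW}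
    (hθ : θ ∈ F.ΘW) : MemLp (fun ω => F.bridge q θ (P.A ω, P.W ω)) 2 P.μ :=
  memLp_of_abs_le ((measurable_bridge q θ).comp (P.measurable_A.prodMk P.measurable_W))
    fun _ => abs_bridge_le hF hq hθ _

theorem excess1_nonneg (θ : F.ParW) (p : F.Par1) : 0 ≤ F.excess1 P θ p :=
  integral_nonneg fun _ => Finset.sum_nonneg fun _ _ => sq_nonneg _

/-- The stage 1 risk is the excess risk and a term that does not depend on the prediction. -/
theorem integral_loss1_eq (hF : F.Bounded M) {θ : F.ParW} (hθ : θ ∈ F.ΘW) {p : F.Par1}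
    (hp : p ∈ F.stage1) :
    ∫ ω, F.loss1 θ p (P.W ω, P.A ω, P.Z ω) ∂P.μ = F.excess1 P θ p +
      ∑ j, ∫ ω, (F.ψW θ (P.W ω) j - F.featMean P θ j ω) ^ 2 ∂P.μ := by
  unfold loss1 sqNorm excess1
  simp only [Pi.sub_apply]
  have h1 : ∀ j, Integrable
      (fun ω => (F.ψW θ (P.W ω) j - F.pred1 p (P.A ω) (P.Z ω) j) ^ 2) P.μ := fun j =>
    ((memLp_ψW hF hθ j).sub (memLp_pred1 hF hp j)).integrable_sq
  have h2 : ∀ j, Integrable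
      (fun ω => (F.featMean P θ j ω - F.pred1 p (P.A ω) (P.Z ω) j) ^ 2) P.μ := fun j =>
    ((memLp_featMean hF hθ j).sub (memLp_pred1 hF hp j)).integrable_sq
  rw [integral_finsetSum _ fun j _ => h1 j, integral_finsetSum _ fun j _ => h2 j,
    ← Finset.sum_add_distrib]
  exact Finset.sum_congr rfl fun j _ => integral_sq_sub_eq Population.sigmaAZ_le
    (memLp_ψW hF hθ j) (memLp_pred1 hF hp j) (stronglyMeasurable_comp_AZ (measurable_pred1 p j))

theorem excess1_le_four (hF : F.Bounded M) {θ : F.ParW} (hθ : θ ∈ F.ΘW) {p : F.Par1}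
    (hp : p ∈ F.stage1) : F.excess1 P θ p ≤ 4 := by
  have h1 := integral_loss1_eq (P := P) hF hθ hp
  have h2 := abs_integral_le_of_abs_le P.μ fun ω =>
    abs_loss1_le hF hθ hp (P.W ω, P.A ω, P.Z ω)
  have h3 : 0 ≤ ∑ j, ∫ ω, (F.ψW θ (P.W ω) j - F.featMean P θ j ω) ^ 2 ∂P.μ :=
    Finset.sum_nonneg fun j _ => integral_nonneg fun _ => sq_nonneg _
  linarith [(abs_le.1 h2).2]

theorem kappa1_eq : F.kappa1 P = ⨆ θ : F.ΘW, ⨅ p : F.stage1, F.excess1 P θ p := rfl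

theorem kappa1_nonneg : 0 ≤ F.kappa1 P :=
  Real.iSup_nonneg fun _ => Real.iInf_nonneg fun _ => excess1_nonneg _ _

/-- A real supremum dominates its terms only for a bounded family. Excess risks are at most 4, and p
passes this bound to the infima. -/
theorem iInf_excess1_le_kappa1 (hF : F.Bounded M) {θ : F.ParW} (hθ : θ ∈ F.ΘW)
    {p : F.Par1} (hp : p ∈ F.stage1) : ⨅ p : F.stage1, F.excess1 P θ p ≤ F.kappa1 P := by
  rw [kappa1_eq]
  refine le_ciSup (f := fun θ : F.ΘW => ⨅ p : F.stage1, F.excess1 P θ p) ⟨4, ?_⟩ ⟨θ, hθ⟩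
  rintro _ ⟨θ', rfl⟩
  exact (ciInf_le ⟨0, by rintro _ ⟨p', rfl⟩; exact excess1_nonneg _ _⟩ ⟨p, hp⟩).trans
    (excess1_le_four hF θ'.2 hp)

/-- The oracle inequality of stage 1. -/
theorem excess1_le_of_isStage1Minimizer (hF : F.Bounded M) {m : ℕ} {S : Fin m → 𝒲 × 𝒜 × 𝒵}
    {lam ε Δ : ℝ} {est : F.ParW → F.Par1} (hest : F.IsStage1Minimizer S lam est) (hlam : 0 ≤ lam)
    (hreg : ∀ p ∈ F.stage1, lam * sqFrob p.1 ≤ ε)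
    (hΔ : ∀ θ ∈ F.ΘW, ∀ p ∈ F.stage1, |∫ ω, F.loss1 θ p (P.W ω, P.A ω, P.Z ω) ∂P.μ -
      (1 / (m : ℝ)) * ∑ i, F.loss1 θ p (S i)| ≤ Δ) {θ : F.ParW} (hθ : θ ∈ F.ΘW) :
    F.excess1 P θ (est θ) ≤ F.kappa1 P + 2 * Δ + ε := by
  obtain ⟨hmem, hmin⟩ := hest θ hθ
  have : Nonempty F.stage1 := ⟨⟨_, hmem⟩⟩
  suffices h : F.excess1 P θ (est θ) - 2 * Δ - ε ≤ ⨅ p : F.stage1, F.excess1 P θ p by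
    linarith [iInf_excess1_le_kappa1 (P := P) hF hθ hmem]
  refine le_ciInf fun p => ?_
  have h1 := integral_loss1_eq (P := P) hF hθ hmem
  have h2 := integral_loss1_eq (P := P) hF hθ p.2
  have h3 := (abs_le.1 (hΔ θ hθ _ hmem)).2
  have h4 := (abs_le.1 (hΔ θ hθ _ p.2)).1
  have h5 := isMinOn_iff.1 hmin p p.2
  have h6 := mul_nonneg hlam (sqFrob_nonneg (est θ).1)
  have h7 := hreg p p.2
  -- The noise term is common to both risks and cancels. What remains is one deviation for each of
  -- the two predictions and the penalty of the comparator.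
  unfold empLoss1 at h5
  linarith

/-- The conditional mean of the outcome. -/
noncomputable def outMean (P : Population Ω 𝒰 𝒜 𝒵 𝒲 𝒞) : Ω → ℝ := P.μ[P.Y | P.sigmaAZ]

/-- The conditional mean of a bridge function of the model. -/
noncomputable def bridgeCond (F : FeatureModel 𝒜 𝒵 𝒲) (P : Population Ω 𝒰 𝒜 𝒵 𝒲 𝒞)
    (r : F.Par2 × F.ParW) : Ω → ℝ :=
  P.μ[fun ω => F.bridge r.1 r.2 (P.A ω, P.W ω) | P.sigmaAZ]

/-- The coefficients depend on A alone and come out of the conditional expectation. This linearity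
in the features of W is why stage 2 may plug in stage 1 predictions. -/
theorem bridgeCond_ae_eq (hF : F.Bounded M) {q : F.Par2} (hq : q ∈ F.stage2) {θ : F.ParW}
    (hθ : θ ∈ F.ΘW) :
    F.bridgeCond P (q, θ) =ᵐ[P.μ] fun ω => ∑ j, F.coef q (P.A ω) j * F.featMean P θ j ω := by
  have hc : ∀ j, StronglyMeasurable[P.sigmaAZ] fun ω => F.coef q (P.A ω) j := fun j =>
    stronglyMeasurable_comp_AZ ((measurable_coef q j).comp measurable_fst)
  have hcL : ∀ j, MemLp (fun ω => F.coef q (P.A ω) j) 2 P.μ := fun j =>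
    memLp_of_abs_le ((measurable_coef q j).comp P.measurable_A)
      fun ω => abs_le_of_sqNorm_le (sqNorm_coef_le hF hq (P.A ω)) j
  have hint : ∀ j, Integrable (fun ω => F.coef q (P.A ω) j * F.ψW θ (P.W ω) j) P.μ := fun j =>
    (hcL j).integrable_mul (memLp_ψW hF hθ j)
  have h1 : (fun ω => F.bridge q θ (P.A ω, P.W ω)) =
      ∑ j, fun ω => F.coef q (P.A ω) j * F.ψW θ (P.W ω) j := by
    ext ω
    rw [bridge_eq, Finset.sum_apply]
  have h2 := condExp_finsetSum (s := Finset.univ) (fun j _ => hint j) P.sigmaAZ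
  have h3 : ∀ᵐ ω ∂P.μ, ∀ j, (P.μ[fun ω => F.coef q (P.A ω) j * F.ψW θ (P.W ω) j | P.sigmaAZ]) ω =
      F.coef q (P.A ω) j * F.featMean P θ j ω :=
    ae_all_iff.2 fun j => condExp_mul_of_stronglyMeasurable_left (hc j) (hint j)
      ((memLp_ψW hF hθ j).integrable one_le_two)
  unfold bridgeCond
  rw [h1]
  filter_upwards [h2, h3] with ω w2 w3
  rw [w2, Finset.sum_apply]
  exact Finset.sum_congr rfl fun j _ => w3 j

/-- Both functions pair the same coefficient vector, of norm at most |M|, with E[ψ(W) | A, Z] and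
with the stage 1 prediction; pointwise Cauchy–Schwarz bounds the difference. -/
theorem rms_bridgeCond_sub_pred2_le (hF : F.Bounded M) {q : F.Par2} (hq : q ∈ F.stage2)
    {θ : F.ParW} (hθ : θ ∈ F.ΘW) {p : F.Par1} (hp : p ∈ F.stage1) :
    rms P.μ (fun ω => F.bridgeCond P (q, θ) ω - F.pred2 q p (P.A ω) (P.Z ω)) ≤
      |M| * Real.sqrt (F.excess1 P θ p) := by
  rw [← Real.sqrt_sq_eq_abs, ← Real.sqrt_mul (sq_nonneg M)]
  refine Real.sqrt_le_sqrt ?_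
  unfold excess1
  rw [← integral_const_mul]
  refine integral_mono_of_nonneg (Filter.Eventually.of_forall fun _ => sq_nonneg _) ?_ ?_
  · exact (integrable_finsetSum _ fun j _ =>
      ((memLp_featMean hF hθ j).sub (memLp_pred1 hF hp j)).integrable_sq).const_mul _
  · filter_upwards [bridgeCond_ae_eq (P := P) hF hq hθ] with ω hω
    rw [hω, pred2_eq, ← Finset.sum_sub_distrib]
    simp_rw [← mul_sub]
    exact sq_sum_mul_le (sqNorm_coef_le hF hq _) _

theorem memLp_outMean (hY : ∀ᵐ ω ∂P.μ, |P.Y ω| ≤ M) : MemLp (outMean P) 2 P.μ :=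
  (Population.memLp_Y hY).condExp one_le_two

theorem memLp_bridgeCond (hF : F.Bounded M) {q : F.Par2} (hq : q ∈ F.stage2) {θ : F.ParW}
    (hθ : θ ∈ F.ΘW) : MemLp (F.bridgeCond P (q, θ)) 2 P.μ :=
  (memLp_bridge hF hq hθ).condExp one_le_two

theorem integral_loss2_eq (hF : F.Bounded M) (hY : ∀ᵐ ω ∂P.μ, |P.Y ω| ≤ M) {q : F.Par2}
    (hq : q ∈ F.stage2) {p : F.Par1} (hp : p ∈ F.stage1) :
    ∫ ω, F.loss2 q p (P.Y ω, P.A ω, P.Z ω) ∂P.μ =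
      rms P.μ (fun ω => outMean P ω - F.pred2 q p (P.A ω) (P.Z ω)) ^ 2 +
        ∫ ω, (P.Y ω - outMean P ω) ^ 2 ∂P.μ := by
  rw [rms, Real.sq_sqrt (integral_nonneg fun _ => sq_nonneg _)]
  exact integral_sq_sub_eq Population.sigmaAZ_le (Population.memLp_Y hY) (memLp_pred2 hF hq hp)
    (stronglyMeasurable_comp_AZ (measurable_pred2 q p))

theorem kappa2_eq : F.kappa2 P = ⨅ r : (F.stage2 ×ˢ F.ΘW : Set (F.Par2 × F.ParW)),
    rms P.μ fun ω => outMean P ω - F.bridgeCond P (r : F.Par2 × F.ParW) ω := rfl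

theorem kappa2_nonneg : 0 ≤ F.kappa2 P := by
  rw [kappa2_eq]
  exact Real.iInf_nonneg fun _ => rms_nonneg _

/-- The oracle inequality of stage 2. -/
theorem rms_outMean_sub_bridgeCond_le (hF : F.Bounded M) (hY : ∀ᵐ ω ∂P.μ, |P.Y ω| ≤ M) {n : ℕ}
    {S : Fin n → ℝ × 𝒜 × 𝒵} {lam ε Δ D : ℝ} {est : F.ParW → F.Par1} {r : F.Par2 × F.ParW}
    (hr : F.IsStage2Minimizer S lam est r) (hest : ∀ θ ∈ F.ΘW, est θ ∈ F.stage1)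
    (hD : ∀ θ ∈ F.ΘW, F.excess1 P θ (est θ) ≤ D) (hlam : 0 ≤ lam)
    (hreg : ∀ q ∈ F.stage2, lam * sqNorm q.1 ≤ ε) (hε : 0 ≤ ε) (hΔ0 : 0 ≤ Δ)
    (hΔ : ∀ q ∈ F.stage2, ∀ p ∈ F.stage1, |∫ ω, F.loss2 q p (P.Y ω, P.A ω, P.Z ω) ∂P.μ -
      (1 / (n : ℝ)) * ∑ i, F.loss2 q p (S i)| ≤ Δ) :
    rms P.μ (fun ω => outMean P ω - F.bridgeCond P r ω) ≤
      F.kappa2 P + 2 * (|M| * Real.sqrt D) + Real.sqrt (2 * Δ + ε) := by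
  obtain ⟨⟨hrq, hrθ⟩, hmin⟩ := hr
  obtain ⟨q₀, θ₀⟩ := r
  simp only at hrq hrθ
  have hne : Nonempty (F.stage2 ×ˢ F.ΘW : Set (F.Par2 × F.ParW)) := ⟨⟨(q₀, θ₀), hrq, hrθ⟩⟩
  have hYL := memLp_outMean hY
  have happrox : ∀ q ∈ F.stage2, ∀ θ ∈ F.ΘW,
      rms P.μ (fun ω => F.bridgeCond P (q, θ) ω - F.pred2 q (est θ) (P.A ω) (P.Z ω)) ≤
        |M| * Real.sqrt D := fun q hq θ hθ =>
    (rms_bridgeCond_sub_pred2_le hF hq hθ (hest θ hθ)).trans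
      (mul_le_mul_of_nonneg_left (Real.sqrt_le_sqrt (hD θ hθ)) (abs_nonneg _))
  have hsymm : ∀ f g : Ω → ℝ, rms P.μ (fun ω => f ω - g ω) = rms P.μ fun ω => g ω - f ω :=
    fun f g => by
      unfold rms
      congr 2
      ext ω
      ring
  have htri : ∀ f g h : Ω → ℝ, MemLp f 2 P.μ → MemLp g 2 P.μ → MemLp h 2 P.μ →
      rms P.μ (fun ω => f ω - h ω) ≤
        rms P.μ (fun ω => f ω - g ω) + rms P.μ fun ω => g ω - h ω := fun f g h hf hg hh => by
    have := rms_add_le (hf.sub hg) (hg.sub hh)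
    simp only [Pi.sub_apply, sub_add_sub_cancel] at this
    exact this
  -- Empirical minimality gives x² ≤ y² + (2Δ + ε), hence x ≤ y + √(2Δ + ε). Roots are taken here
  -- because κ₂ is an unsquared distance.
  have hkey : ∀ q ∈ F.stage2, ∀ θ ∈ F.ΘW,
      rms P.μ (fun ω => outMean P ω - F.pred2 q₀ (est θ₀) (P.A ω) (P.Z ω)) ≤
        rms P.μ (fun ω => outMean P ω - F.pred2 q (est θ) (P.A ω) (P.Z ω)) +
          Real.sqrt (2 * Δ + ε) := by
    intro q hq θ hθ
    have h1 := integral_loss2_eq (P := P) hF hY hrq (hest _ hrθ)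
    have h2 := integral_loss2_eq (P := P) hF hY hq (hest _ hθ)
    have h3 := (abs_le.1 (hΔ q₀ hrq _ (hest _ hrθ))).2
    have h4 := (abs_le.1 (hΔ q hq _ (hest _ hθ))).1
    have h5 := isMinOn_iff.1 hmin (q, θ) ⟨hq, hθ⟩
    have h6 := mul_nonneg hlam (sqNorm_nonneg q₀.1)
    have h7 := hreg q hq
    unfold empLoss2 at h5
    simp only at h5
    refine abs_le_of_sq_le_sq' ?_ (add_nonneg (rms_nonneg _) (Real.sqrt_nonneg _)) |>.2
    have h8 := Real.sq_sqrt (show 0 ≤ 2 * Δ + ε by linarith)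
    have h9 := mul_nonneg (rms_nonneg (μ := P.μ)
      (fun ω => outMean P ω - F.pred2 q (est θ) (P.A ω) (P.Z ω)))
      (Real.sqrt_nonneg (2 * Δ + ε))
    rw [add_sq]
    linarith
  suffices h : rms P.μ (fun ω => outMean P ω - F.bridgeCond P (q₀, θ₀) ω) -
      2 * (|M| * Real.sqrt D) - Real.sqrt (2 * Δ + ε) ≤ F.kappa2 P by linarith
  rw [kappa2_eq]
  refine le_ciInf fun r => ?_
  obtain ⟨⟨q, θ⟩, hq, hθ⟩ := r
  simp only at hq hθ ⊢
  -- The triangle inequality passes through a plug-in prediction at the estimate and again at the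
  -- comparator, which produces the factor 2 on |M|√D.
  have t1 := htri _ _ _ hYL (memLp_pred2 (P := P) hF hrq (hest _ hrθ))
    (memLp_bridgeCond hF hrq hrθ)
  have t2 := htri _ _ _ hYL (memLp_bridgeCond hF hq hθ) (memLp_pred2 (P := P) hF hq (hest _ hθ))
  rw [hsymm (fun ω => F.pred2 q₀ (est θ₀) (P.A ω) (P.Z ω))] at t1
  linarith [happrox q₀ hrq θ₀ hrθ, happrox q hq θ hθ, hkey q hq θ hθ]

end FeatureModel

/-! ### Truncation -/

section Truncation

/-- The truncation of `y` to the interval `[-B, B]`. -/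
def clamp (B y : ℝ) : ℝ := max (-B) (min B y)

theorem measurable_clamp (B : ℝ) : Measurable (clamp B) :=
  measurable_const.max (measurable_const.min measurable_id)

theorem abs_clamp_le {B : ℝ} (hB : 0 ≤ B) (y : ℝ) : |clamp B y| ≤ B :=
  abs_le.2 ⟨le_max_left _ _, max_le (by linarith) (min_le_left _ _)⟩

theorem clamp_eq {B y : ℝ} (h : |y| ≤ B) : clamp B y = y := by
  rw [clamp, min_eq_right (abs_le.1 h).2, max_eq_right (abs_le.1 h).1]

end Truncation

/-! ### Empirical complexity of a class and held-out averages -/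

section Samples

variable {E : Type*} {n : ℕ}

/-- The suprema see only the range of f, so a class may be indexed by its parameters, which carry
the topology used for dense sequences. -/
theorem rad_eq_empRademacher {T : Type*} (f : T → E → ℝ) {G : Set (E → ℝ)} (hG : Set.range f = G)
    (S : Fin n → E) : rad f S = empRademacher G S := by
  subst hG
  unfold rad empRademacher signedSup
  congr 1
  refine Finset.sum_congr rfl fun σ _ => ?_
  exact Set.rangeFactorization_surjective.iSup_comp (g := fun g : Set.range f =>
    (1 / (n : ℝ)) * ∑ j, sgn (σ j) * (g : E → ℝ) (S j))

/-- For any one member, its signed averages at σ and −σ cancel, so the two suprema have nonnegative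
sum. -/
theorem rad_nonneg {ι : Type*} [Nonempty ι] {f : ι → E → ℝ} {B : ℝ} (hB0 : 0 ≤ B)
    (hB : ∀ i x, |f i x| ≤ B) (S : Fin n → E) : 0 ≤ rad f S := by
  obtain ⟨i⟩ := ‹Nonempty ι›
  have hflip : ∑ σ : Fin n → Bool, signedSup f (fun j => !σ j) S =
      ∑ σ : Fin n → Bool, signedSup f σ S :=
    Fintype.sum_equiv (Equiv.piCongrRight fun _ : Fin n => Equiv.boolNot) _ _ fun σ => rfl
  have hpos : 0 ≤ ∑ σ : Fin n → Bool, (signedSup f σ S + signedSup f (fun j => !σ j) S) := by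
    refine Finset.sum_nonneg fun σ _ => ?_
    have h1 := le_ciSup (bddAbove_of_abs_le (abs_signed_avg_le hB0 hB σ S)) i
    have h2 := le_ciSup (bddAbove_of_abs_le (abs_signed_avg_le hB0 hB (fun j => !σ j) S)) i
    simp only [sgn_not, neg_mul, Finset.sum_neg_distrib] at h2
    have h3 : signedSup f σ S = ⨆ i, (1 / (n : ℝ)) * ∑ j, sgn (σ j) * f i (S j) := rfl
    have h4 : signedSup f (fun j => !σ j) S =
        ⨆ i, (1 / (n : ℝ)) * -∑ j, sgn (σ j) * f i (S j) := by
      simp [signedSup, sgn_not]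
    rw [h3, h4]
    linarith
  rw [Finset.sum_add_distrib, hflip] at hpos
  exact mul_nonneg (by positivity) (by linarith)

variable [MeasurableSpace E]

/-- Chebyshev's inequality for the average of a bounded function. -/
theorem measure_abs_avg_dev_gt_le (ν : Measure E) [IsProbabilityMeasure ν] {g : E → ℝ}
    (hg : Measurable g) {B η : ℝ} (hB0 : 0 < B) (hB : ∀ x, |g x| ≤ B) (hn : 0 < n) (hη : 0 < η) :
    (Measure.pi fun _ : Fin n => ν) {S | 2 * B / Real.sqrt η * (1 / Real.sqrt n) <
      |∫ x, g x ∂ν - (1 / (n : ℝ)) * ∑ j, g (S j)|} ≤ ENNReal.ofReal (2 * η) := by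
  have hn' : (0 : ℝ) < n := by exact_mod_cast hn
  have hside : ∀ f : E → ℝ, Measurable f → (∀ x, |f x| ≤ B) →
      (Measure.pi fun _ : Fin n => ν) {S | 2 * B / Real.sqrt η * (1 / Real.sqrt n) <
        ∫ x, f x ∂ν - (1 / (n : ℝ)) * ∑ j, f (S j)} ≤ ENNReal.ofReal η := by
    intro f hf hfB
    -- A one-member family: its deviation has mean zero, so no complexity term arises.
    have hdev : ∀ S : Fin n → E, supDev ν (fun _ : Unit => f) S =
        ∫ x, f x ∂ν - (1 / (n : ℝ)) * ∑ j, f (S j) := fun S => ciSup_const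
    have hmean : ∫ S, supDev ν (fun _ : Unit => f) S ∂(Measure.pi fun _ : Fin n => ν) ≤ 0 := by
      have hm : Measurable fun S : Fin n → E => (1 / (n : ℝ)) * ∑ j, f (S j) :=
        (Finset.measurable_fun_sum _ fun j _ => hf.comp (measurable_pi_apply j)).const_mul _
      simp_rw [hdev]
      rw [integral_sub (integrable_const _) (integrable_of_abs_le hm
        fun S => abs_avg_le hB0.le fun j => hfB (S j)), integral_avg_pi ν hf hfB hn]
      simp
    have h := measure_gt_le_of_boundedDiff ν (measurable_supDev ν fun _ : Unit => hf)
      (fun S => abs_iSup_le (abs_dev_le ν hB0.le (fun _ => hfB) S))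
      (boundedDiff_supDev ν hB0.le fun _ => hfB) hmean hn (by positivity) hη
    have hc : 2 * B / (n : ℝ) * Real.sqrt n / Real.sqrt η
        = 2 * B / Real.sqrt η * (1 / Real.sqrt n) := by
      have h1 : Real.sqrt n ≠ 0 := by positivity
      have h2 : (n : ℝ) = Real.sqrt n * Real.sqrt n := (Real.mul_self_sqrt hn'.le).symm
      have h3 : Real.sqrt η ≠ 0 := by positivity
      rw [h2, Real.sqrt_mul_self (Real.sqrt_nonneg _)]
      field_simp
    rw [hc] at h
    simp_rw [hdev] at h
    exact h
  rw [two_mul η, ENNReal.ofReal_add hη.le hη.le]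
  refine le_trans (measure_mono ?_) ((measure_union_le _ _).trans (add_le_add (hside g hg hB)
    (hside (fun x => -g x) hg.neg fun x => by rw [abs_neg]; exact hB x)))
  intro S hS
  rw [Set.mem_ofPred_eq, lt_abs] at hS
  refine hS.imp (fun h => h) fun h => ?_
  rw [Set.mem_ofPred_eq]
  refine h.trans_le (le_of_eq ?_)
  rw [integral_neg, Finset.sum_neg_distrib]
  ring

theorem IsIIDSample.map_eq {Ω' : Type*} [MeasurableSpace Ω'] {Q : Measure Ω'}
    [IsProbabilityMeasure Q] {ν : Measure E} {S : Fin n → Ω' → E} (hS : IsIIDSample Q ν S) :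
    Q.map (fun ω j => S j ω) = Measure.pi fun _ : Fin n => ν := by
  rw [(iIndepFun_iff_map_fun_eq_pi_map fun j => (hS.1 j).aemeasurable).1 hS.2.1]
  congr
  exact funext hS.2.2

/-- Chebyshev's inequality for the average, over a held-out sample, of a bounded function that
depends on an independent random parameter. -/
theorem measure_heldOut_avg_dev_gt_le {Ω' R : Type*} [MeasurableSpace Ω'] [MeasurableSpace R]
    {Q : Measure Ω'} [IsProbabilityMeasure Q] {ν : Measure E} [IsProbabilityMeasure ν]
    {S : Fin n → Ω' → E} (hS : IsIIDSample Q ν S) {φ : R → E → ℝ}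
    (hφ : Measurable (Function.uncurry φ)) {r : Ω' → R} (hr : Measurable r)
    (hind : IndepFun r (fun ω j => S j ω) Q) {B η : ℝ} (hB0 : 0 < B)
    (hB : ∀ᵐ ω ∂Q, ∀ x, |φ (r ω) x| ≤ B) (hn : 0 < n) (hη : 0 < η) :
    Q {ω | 2 * B / Real.sqrt η * (1 / Real.sqrt n) <
      |∫ x, φ (r ω) x ∂ν - (1 / (n : ℝ)) * ∑ j, φ (r ω) (S j ω)|} ≤ ENNReal.ofReal (2 * η) := by
  have hSm : Measurable fun ω j => S j ω := measurable_pi_iff.2 hS.1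
  -- The bound B is known only at r ω for almost every ω. Truncation makes it hold at every
  -- parameter without changing those values.
  set g : R → E → ℝ := fun r x => clamp B (φ r x)
  have hg : Measurable (Function.uncurry g) := (measurable_clamp B).comp hφ
  have hgr : ∀ r, Measurable (g r) := fun r => hg.comp (measurable_const.prodMk measurable_id)
  set D : Set (R × (Fin n → E)) := {p | 2 * B / Real.sqrt η * (1 / Real.sqrt n) <
    |∫ x, g p.1 x ∂ν - (1 / (n : ℝ)) * ∑ j, g p.1 (p.2 j)|}
  have hD : MeasurableSet D := by
    refine measurableSet_lt measurable_const (Measurable.abs (Measurable.sub ?_ ?_))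
    · exact (hg.stronglyMeasurable.integral_prod_right (ν := ν)).measurable.comp measurable_fst
    · exact (Finset.measurable_fun_sum _ fun j _ => hg.comp
        (measurable_fst.prodMk ((measurable_pi_apply j).comp measurable_snd))).const_mul _
  have hae : ({ω | 2 * B / Real.sqrt η * (1 / Real.sqrt n) <
      |∫ x, φ (r ω) x ∂ν - (1 / (n : ℝ)) * ∑ j, φ (r ω) (S j ω)|} : Set Ω') ≤ᵐ[Q]
        (fun ω => (r ω, fun j => S j ω)) ⁻¹' D := by
    filter_upwards [hB] with ω hω hmem
    have : g (r ω) = φ (r ω) := funext fun x => clamp_eq (hω x)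
    change _ < |∫ x, g (r ω) x ∂ν - (1 / (n : ℝ)) * ∑ j, g (r ω) (S j ω)|
    rw [this]
    exact hmem
  refine (measure_mono_ae hae).trans ?_
  have : IsProbabilityMeasure (Q.map r) := Measure.isProbabilityMeasure_map hr.aemeasurable
  -- By independence the joint law of parameter and sample is a product, so Chebyshev applies with
  -- the parameter frozen.
  rw [← Measure.map_apply (hr.prodMk hSm) hD,
    (indepFun_iff_map_prod_eq_prod_map_map hr.aemeasurable hSm.aemeasurable).1 hind, hS.map_eq,
    Measure.prod_apply hD]
  calc ∫⁻ a, (Measure.pi fun _ : Fin n => ν) (Prod.mk a ⁻¹' D) ∂(Q.map r)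
      ≤ ∫⁻ _, ENNReal.ofReal (2 * η) ∂(Q.map r) := lintegral_mono fun a =>
        measure_abs_avg_dev_gt_le ν (hgr a) hB0 (fun x => abs_clamp_le hB0.le _) hn hη
    _ = ENNReal.ofReal (2 * η) := by simp

end Samples

/-! ### Deviation events for the two stages and the held-out sample -/

namespace FeatureModel

variable {𝒜 𝒵 𝒲 Ω 𝒰 𝒞 Ω' : Type*} [MeasurableSpace 𝒜] [MeasurableSpace 𝒵] [MeasurableSpace 𝒲]
  [MeasurableSpace Ω] [MeasurableSpace 𝒰] [MeasurableSpace 𝒞] [MeasurableSpace Ω']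
  {F : FeatureModel 𝒜 𝒵 𝒲} {P : Population Ω 𝒰 𝒜 𝒵 𝒲 𝒞} {M η : ℝ} {Q : Measure Ω'}
  [IsProbabilityMeasure Q]

instance : SecondCountableTopology F.Par1 :=
  inferInstanceAs (SecondCountableTopology
    ((Fin F.dψW → Fin F.dφA × Fin F.dφZ → ℝ) × (Fin F.pφA → ℝ) × (Fin F.pφZ → ℝ)))

theorem measure_stage1_deviation_le (hF : F.Bounded M) {m : ℕ} {S : Fin m → Ω' → 𝒲 × 𝒜 × 𝒵}
    (hS : IsIIDSample Q (P.μ.map fun ω => (P.W ω, P.A ω, P.Z ω)) S) (hm : 0 < m) (hη : 0 < η)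
    (hW : F.ΘW.Nonempty) (h1 : F.stage1.Nonempty) :
    Q {ω | ¬ (0 ≤ empRademacher F.H1 (fun i => S i ω) ∧ ∀ θ ∈ F.ΘW, ∀ p ∈ F.stage1,
      |∫ ω', F.loss1 θ p (P.W ω', P.A ω', P.Z ω') ∂P.μ -
        (1 / (m : ℝ)) * ∑ i, F.loss1 θ p (S i ω)| ≤
      2 * empRademacher F.H1 (fun i => S i ω) + 24 / Real.sqrt η * (1 / Real.sqrt m))} ≤
        ENNReal.ofReal (2 * η) := by
  have hX : Measurable fun ω => (P.W ω, P.A ω, P.Z ω) :=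
    P.measurable_W.prodMk (P.measurable_A.prodMk P.measurable_Z)
  have : IsProbabilityMeasure (P.μ.map fun ω => (P.W ω, P.A ω, P.Z ω)) :=
    Measure.isProbabilityMeasure_map hX.aemeasurable
  let f : (F.ΘW ×ˢ F.stage1 : Set (F.ParW × F.Par1)) → 𝒲 × 𝒜 × 𝒵 → ℝ :=
    fun t => F.loss1 t.1.1 t.1.2
  have : Nonempty (F.ΘW ×ˢ F.stage1 : Set (F.ParW × F.Par1)) := (hW.prod h1).to_subtype
  have hfB : ∀ t x, |f t x| ≤ 4 := fun t => abs_loss1_le hF t.2.1 t.2.2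
  have hrange : Set.range f = F.H1 := by
    ext g
    constructor
    · rintro ⟨⟨⟨θ, p⟩, hθ, hp⟩, rfl⟩
      exact ⟨θ, hθ, p, hp, rfl⟩
    · rintro ⟨θ, hθ, p, hp, rfl⟩
      exact ⟨⟨(θ, p), hθ, hp⟩, rfl⟩
  have key := measure_uniform_deviation_le (f := f) hS (fun t => measurable_loss1 _ _)
    (fun x => (continuous_loss1 x).comp continuous_subtype_val) (by norm_num : (0 : ℝ) < 4) hfB
    hm hη
  refine le_trans (measure_mono fun ω hω => ?_) key
  rw [Set.mem_ofPred_eq, ← rad_eq_empRademacher f hrange] at hω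
  simp only [rad_nonneg (by norm_num : (0 : ℝ) ≤ 4) hfB, true_and, not_forall, not_le] at hω
  obtain ⟨θ, hθ, p, hp, h⟩ := hω
  refine ⟨⟨(θ, p), hθ, hp⟩, ?_⟩
  rw [integral_map hX.aemeasurable (measurable_loss1 _ _).aestronglyMeasurable]
  norm_num
  norm_num at h
  exact h

/-- The stage 2 loss with the outcome truncated to `[-M, M]`. -/
noncomputable def clampLoss2 (F : FeatureModel 𝒜 𝒵 𝒲) (M : ℝ) (q : F.Par2) (p : F.Par1)
    (x : ℝ × 𝒜 × 𝒵) : ℝ :=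
  F.loss2 q p (clamp M x.1, x.2)

theorem clampLoss2_eq {x : ℝ × 𝒜 × 𝒵} (hx : |x.1| ≤ M) (q : F.Par2) (p : F.Par1) :
    F.clampLoss2 M q p x = F.loss2 q p x := by
  rw [clampLoss2, clamp_eq hx]

/-- Truncated outcome and prediction both lie in [−M, M], so 4M² would do; the extra 1 keeps the
bound positive when M = 0. -/
theorem abs_clampLoss2_le (hF : F.Bounded M) (hM : 0 ≤ M) {q : F.Par2} (hq : q ∈ F.stage2)
    {p : F.Par1} (hp : p ∈ F.stage1) (x : ℝ × 𝒜 × 𝒵) :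
    |F.clampLoss2 M q p x| ≤ 4 * M ^ 2 + 1 := by
  have h1 := abs_le.1 (abs_clamp_le hM x.1)
  have h2 := abs_le.1 (abs_pred2_le hF hq hp x.2.1 x.2.2)
  rw [abs_of_nonneg hM] at h2
  unfold clampLoss2 loss2
  rw [abs_of_nonneg (sq_nonneg _)]
  nlinarith [h1.1, h1.2, h2.1, h2.2]

theorem measurable_clampLoss2 (q : F.Par2) (p : F.Par1) : Measurable (F.clampLoss2 M q p) := by
  have : Measurable fun x : ℝ × 𝒜 × 𝒵 => clamp M x.1 - F.pred2 q p x.2.1 x.2.2 :=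
    ((measurable_clamp M).comp measurable_fst).sub ((measurable_pred2 q p).comp measurable_snd)
  exact this.pow_const 2

theorem continuous_clampLoss2 (x : ℝ × 𝒜 × 𝒵) :
    Continuous fun r : F.Par2 × F.Par1 => F.clampLoss2 M r.1 r.2 x :=
  (continuous_const.sub (continuous_pred2 x.2.1 x.2.2)).pow 2

/-- The outcome is bounded only almost surely, whereas the uniform bound needs losses bounded
everywhere. Truncated losses have the same risks and, for almost every sample, the same averages and
complexity. -/
theorem measure_stage2_deviation_le (hF : F.Bounded M) (hM : 0 ≤ M)
    (hY : ∀ᵐ ω ∂P.μ, |P.Y ω| ≤ M) {n : ℕ} {S : Fin n → Ω' → ℝ × 𝒜 × 𝒵}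
    (hS : IsIIDSample Q (P.μ.map fun ω => (P.Y ω, P.A ω, P.Z ω)) S) (hn : 0 < n) (hη : 0 < η)
    (h2 : F.stage2.Nonempty) (h1 : F.stage1.Nonempty) :
    Q {ω | ¬ (0 ≤ empRademacher F.H2 (fun i => S i ω) ∧ ∀ q ∈ F.stage2, ∀ p ∈ F.stage1,
      |∫ ω', F.loss2 q p (P.Y ω', P.A ω', P.Z ω') ∂P.μ -
        (1 / (n : ℝ)) * ∑ i, F.loss2 q p (S i ω)| ≤
      2 * empRademacher F.H2 (fun i => S i ω) +
        6 * (4 * M ^ 2 + 1) / Real.sqrt η * (1 / Real.sqrt n))} ≤ ENNReal.ofReal (2 * η) := by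
  have hX : Measurable fun ω => (P.Y ω, P.A ω, P.Z ω) :=
    P.measurable_Y.prodMk (P.measurable_A.prodMk P.measurable_Z)
  have : IsProbabilityMeasure (P.μ.map fun ω => (P.Y ω, P.A ω, P.Z ω)) :=
    Measure.isProbabilityMeasure_map hX.aemeasurable
  let f : (F.stage2 ×ˢ F.stage1 : Set (F.Par2 × F.Par1)) → ℝ × 𝒜 × 𝒵 → ℝ :=
    fun t => F.clampLoss2 M t.1.1 t.1.2
  let f' : (F.stage2 ×ˢ F.stage1 : Set (F.Par2 × F.Par1)) → ℝ × 𝒜 × 𝒵 → ℝ :=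
    fun t => F.loss2 t.1.1 t.1.2
  have : Nonempty (F.stage2 ×ˢ F.stage1 : Set (F.Par2 × F.Par1)) := (h2.prod h1).to_subtype
  have hfB : ∀ t x, |f t x| ≤ 4 * M ^ 2 + 1 := fun t => abs_clampLoss2_le hF hM t.2.1 t.2.2
  have hrange : Set.range f' = F.H2 := by
    ext g
    constructor
    · rintro ⟨⟨⟨q, p⟩, hq, hp⟩, rfl⟩
      exact ⟨q, hq, p, hp, rfl⟩
    · rintro ⟨q, hq, p, hp, rfl⟩
      exact ⟨⟨(q, p), hq, hp⟩, rfl⟩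
  have hB0 : 0 < 4 * M ^ 2 + 1 := by positivity
  have key := measure_uniform_deviation_le (f := f) hS (fun t => measurable_clampLoss2 _ _)
    (fun x => (continuous_clampLoss2 x).comp continuous_subtype_val) hB0 hfB hn hη
  have hYS : ∀ᵐ ω ∂Q, ∀ i, |(S i ω).1| ≤ M := by
    refine ae_all_iff.2 fun i => ?_
    have hmeas : MeasurableSet {x : ℝ × 𝒜 × 𝒵 | |x.1| ≤ M} :=
      measurableSet_le measurable_fst.abs measurable_const
    have h3 : ∀ᵐ x ∂(Q.map (S i)), |x.1| ≤ M := by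
      rw [hS.2.2 i]
      exact (ae_map_iff hX.aemeasurable hmeas).2 hY
    exact ae_of_ae_map (hS.1 i).aemeasurable h3
  refine le_trans (measure_mono_ae ?_) key
  filter_upwards [hYS] with ω hω hbad
  have hrad : empRademacher F.H2 (fun i => S i ω) = rad f fun i => S i ω := by
    rw [← rad_eq_empRademacher f' hrange]
    unfold rad signedSup
    simp_rw [f, f', clampLoss2_eq (hω _)]
  change ¬ _ at hbad
  rw [hrad] at hbad
  simp only [rad_nonneg hB0.le hfB, true_and, not_forall, not_le] at hbad
  obtain ⟨q, hq, p, hp, h⟩ := hbad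
  refine ⟨⟨(q, p), hq, hp⟩, ?_⟩
  rw [integral_map hX.aemeasurable (measurable_clampLoss2 _ _).aestronglyMeasurable]
  have e1 : ∫ ω', F.clampLoss2 M q p (P.Y ω', P.A ω', P.Z ω') ∂P.μ =
      ∫ ω', F.loss2 q p (P.Y ω', P.A ω', P.Z ω') ∂P.μ := by
    refine integral_congr_ae ?_
    filter_upwards [hY] with ω' hω'
    exact clampLoss2_eq hω' q p
  simp_rw [f, clampLoss2_eq (hω _)]
  rw [e1]
  exact h

theorem measure_heldOut_deviation_le (hF : F.Bounded M) {n : ℕ} {S : Fin n → Ω' → 𝒞 × 𝒲}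
    (hS : IsIIDSample Q (P.μ.map fun ω => (P.C ω, P.W ω)) S) (hn : 0 < n) (hη : 0 < η)
    {π : 𝒞 → 𝒜} (hπ : Measurable π) {r : Ω' → F.Par2 × F.ParW} (hr : Measurable r)
    (hind : IndepFun r (fun ω j => S j ω) Q) (hmem : ∀ᵐ ω ∂Q, r ω ∈ F.stage2 ×ˢ F.ΘW) :
    Q {ω | 2 * (|M| + 1) / Real.sqrt η * (1 / Real.sqrt n) <
      |∫ ω', F.bridge (r ω).1 (r ω).2 (π (P.C ω'), P.W ω') ∂P.μ -
        F.estValue π (r ω) fun i => S i ω|} ≤ ENNReal.ofReal (2 * η) := by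
  have hX : Measurable fun ω => (P.C ω, P.W ω) := P.measurable_C.prodMk P.measurable_W
  have : IsProbabilityMeasure (P.μ.map fun ω => (P.C ω, P.W ω)) :=
    Measure.isProbabilityMeasure_map hX.aemeasurable
  have hπW : Measurable fun x : 𝒞 × 𝒲 => (π x.1, x.2) :=
    (hπ.comp measurable_fst).prodMk measurable_snd
  have hm : ∀ r : F.Par2 × F.ParW, Measurable fun x : 𝒞 × 𝒲 => F.bridge r.1 r.2 (π x.1, x.2) :=
    fun r => (measurable_bridge r.1 r.2).comp hπW
  -- A Carathéodory function, continuous in the parameter and measurable in the input, is jointly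
  -- measurable.
  have hφ : Measurable (Function.uncurry fun (r : F.Par2 × F.ParW) (x : 𝒞 × 𝒲) =>
      F.bridge r.1 r.2 (π x.1, x.2)) :=
    measurable_uncurry_of_continuous_of_measurable
      (fun x => continuous_bridge (π x.1, x.2)) hm
  have key := measure_heldOut_avg_dev_gt_le hS hφ hr hind (B := |M| + 1) (by positivity)
    (by
      filter_upwards [hmem] with ω hω x
      exact (abs_bridge_le hF hω.1 hω.2 _).trans (by linarith)) hn hη
  refine le_trans (le_of_eq ?_) key
  congr 1
  ext ω
  rw [Set.mem_ofPred_eq, Set.mem_ofPred_eq,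
    integral_map hX.aemeasurable (hm _).aestronglyMeasurable]
  rfl

end FeatureModel

/-! ### Assembling the bound -/

/-- The three error bounds combine into a constant multiple of the rate. -/
theorem error_le_mul_rate {k₁ k₂ R₁ R₂ s₁ s₂ s₃ c₁ c₂ c₃ t M L e₁ e₂ : ℝ} (hk₁ : 0 ≤ k₁)
    (hk₂ : 0 ≤ k₂) (hR₁ : 0 ≤ R₁) (hR₂ : 0 ≤ R₂) (hs₁ : 0 ≤ s₁) (hs₂ : 0 ≤ s₂) (hs₃ : 0 ≤ s₃)
    (hc₁ : 0 ≤ c₁) (hc₂ : 0 ≤ c₂) (hc₃ : 0 ≤ c₃) (ht : 0 ≤ t)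
    (he₁ : e₁ ≤ t * (k₂ + 2 * (|M| * Real.sqrt (k₁ + 2 * (2 * R₁ + c₁ * s₁) + s₁)) +
      Real.sqrt (2 * (2 * R₂ + c₂ * s₂) + s₂))) (he₂ : e₂ ≤ c₃ * s₃) (hL : L ≤ e₁ + e₂) :
    L ≤ (t * (1 + 2 * (|M| * Real.sqrt (5 + 2 * c₁)) + Real.sqrt (5 + 2 * c₂)) + c₃) *
      (Real.sqrt (k₁ + R₁ + s₁) + k₂ + Real.sqrt (R₂ + s₂) + s₃) := by
  have h1 : Real.sqrt (k₁ + 2 * (2 * R₁ + c₁ * s₁) + s₁) ≤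
      Real.sqrt (5 + 2 * c₁) * Real.sqrt (k₁ + R₁ + s₁) := by
    rw [← Real.sqrt_mul (by positivity)]
    refine Real.sqrt_le_sqrt ?_
    -- The coefficients 1, 4 and 2c₁ + 1 of k₁, R₁ and s₁ are all at most 5 + 2c₁.
    nlinarith [mul_nonneg hc₁ hk₁, mul_nonneg hc₁ hR₁]
  have h2 : Real.sqrt (2 * (2 * R₂ + c₂ * s₂) + s₂) ≤
      Real.sqrt (5 + 2 * c₂) * Real.sqrt (R₂ + s₂) := by
    rw [← Real.sqrt_mul (by positivity)]
    refine Real.sqrt_le_sqrt ?_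
    nlinarith [mul_nonneg hc₂ hR₂]
  set a := Real.sqrt (5 + 2 * c₁)
  set b := Real.sqrt (5 + 2 * c₂)
  set x := Real.sqrt (k₁ + R₁ + s₁)
  set y := Real.sqrt (R₂ + s₂)
  have ha : 0 ≤ a := Real.sqrt_nonneg _
  have hb : 0 ≤ b := Real.sqrt_nonneg _
  have hx : 0 ≤ x := Real.sqrt_nonneg _
  have hy : 0 ≤ y := Real.sqrt_nonneg _
  have hrate : ∀ z, z ≤ x + k₂ + y + s₃ → ∀ c, 0 ≤ c → c * z ≤ c * (x + k₂ + y + s₃) :=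
    fun z hz c hc => mul_le_mul_of_nonneg_left hz hc
  have hMa : 0 ≤ 2 * (|M| * a) := by positivity
  have h3 : t * (k₂ + 2 * (|M| * Real.sqrt (k₁ + 2 * (2 * R₁ + c₁ * s₁) + s₁)) +
      Real.sqrt (2 * (2 * R₂ + c₂ * s₂) + s₂)) ≤ t * ((1 + 2 * (|M| * a) + b) *
        (x + k₂ + y + s₃)) := by
    refine mul_le_mul_of_nonneg_left ?_ ht
    have h4 := mul_le_mul_of_nonneg_left h1 (abs_nonneg M)
    have h5 := hrate x (by linarith) _ hMa
    have h6 := hrate y (by linarith) _ hb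
    linarith
  have h7 := hrate s₃ (by linarith) c₃ hc₃
  calc L ≤ t * ((1 + 2 * (|M| * a) + b) * (x + k₂ + y + s₃)) + c₃ * (x + k₂ + y + s₃) := by
        linarith
    _ = _ := by ring

end DFPV

theorem proposition4 {Ω 𝒰 𝒜 𝒵 𝒲 𝒞 Ω' : Type*} [MeasurableSpace Ω] [StandardBorelSpace Ω]
    [MeasurableSpace 𝒰] [MeasurableSpace 𝒜] [MeasurableSpace 𝒵]
    [MeasurableSpace 𝒲] [StandardBorelSpace 𝒲] [MeasurableSpace 𝒞] [MeasurableSpace Ω']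
    (M : ℝ) (τ ρ : ℝ≥0) (δ : ℝ) (hδ : 0 < δ) :
    ∃ K : ℝ, ∀ (P : DFPV.Population Ω 𝒰 𝒜 𝒵 𝒲 𝒞) (F : DFPV.FeatureModel 𝒜 𝒵 𝒲)
      (hstar : 𝒜 × 𝒲 → ℝ) (π : 𝒞 → 𝒜),
      P.Structural → P.PolicyVariableIndep → P.ConfounderComplete → P.ProxyComplete →
      P.IsBridge hstar → (∀ᵐ ω ∂P.μ, |P.Y ω| ≤ M) → F.Bounded M →
      F.illPosedness P hstar ≤ τ →
      Measurable π → P.Overlap π → P.PolicyL2 π ρ →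
      ∀ (m n n' : ℕ), 0 < m → 0 < n → 0 < n' →
      ∀ (Q : Measure Ω') [IsProbabilityMeasure Q]
        (S₁ : Fin m → Ω' → 𝒲 × 𝒜 × 𝒵) (S₂ : Fin n → Ω' → ℝ × 𝒜 × 𝒵)
        (S₃ : Fin n' → Ω' → 𝒞 × 𝒲)
        (lam₁ lam₂ : ℝ) (est₁ : Ω' → F.ParW → F.Par1) (est₂ : Ω' → F.Par2 × F.ParW),
        DFPV.IsIIDSample Q (P.μ.map fun ω => (P.W ω, P.A ω, P.Z ω)) S₁ →
        DFPV.IsIIDSample Q (P.μ.map fun ω => (P.Y ω, P.A ω, P.Z ω)) S₂ →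
        DFPV.IsIIDSample Q (P.μ.map fun ω => (P.C ω, P.W ω)) S₃ →
        0 ≤ lam₁ → (∀ p ∈ F.stage1, lam₁ * DFPV.sqFrob p.1 ≤ 1 / Real.sqrt m) →
        0 ≤ lam₂ → (∀ q ∈ F.stage2, lam₂ * DFPV.sqNorm q.1 ≤ 1 / Real.sqrt n) →
        (∀ᵐ ω ∂Q, F.IsStage1Minimizer (fun i => S₁ i ω) lam₁ (est₁ ω)) →
        (∀ᵐ ω ∂Q, F.IsStage2Minimizer (fun i => S₂ i ω) lam₂ (est₁ ω) (est₂ ω)) →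
        Measurable est₂ → IndepFun est₂ (fun ω i => S₃ i ω) Q →
        Q {ω | K * DFPV.rate P F (fun i => S₁ i ω) (fun i => S₂ i ω) n' <
            |P.value π - F.estValue π (est₂ ω) (fun i => S₃ i ω)|} ≤ ENNReal.ofReal δ := by
  -- Three bad events, each of probability at most 2η, share δ.
  set η := δ / 6 with hη_def
  have hη : 0 < η := by positivity
  set c₁ := 24 / Real.sqrt η
  set c₂ := 6 * (4 * M ^ 2 + 1) / Real.sqrt η
  set c₃ := 2 * (|M| + 1) / Real.sqrt η
  refine ⟨ρ * τ * (1 + 2 * (|M| * Real.sqrt (5 + 2 * c₁)) + Real.sqrt (5 + 2 * c₂)) + c₃, ?_⟩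
  intro P F hstar π hS hI hC _ hB hY hF hill hπ hO hρ m n n' hm hn hn' Q _ S₁ S₂ S₃ lam₁ lam₂ est₁
    est₂ hS₁ hS₂ hS₃ hlam₁ hreg₁ hlam₂ hreg₂ hest₁ hest₂ hmeas hind
  -- Almost sure statements hold at some point of a probability space. This supplies a point of 𝒲,
  -- the sign of M, and, through the minimizers, nonempty parameter sets.
  obtain ⟨ω₀, hω₀⟩ := hY.exists
  have : Nonempty 𝒲 := ⟨P.W ω₀⟩
  have hM : 0 ≤ M := (abs_nonneg _).trans hω₀
  obtain ⟨ω₁, hω₁, hω₂⟩ := (hest₁.and hest₂).exists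
  have hne2 : F.stage2.Nonempty := ⟨_, hω₂.1.1⟩
  have hneW : F.ΘW.Nonempty := ⟨_, hω₂.1.2⟩
  have hne1 : F.stage1.Nonempty := ⟨_, (hω₁ _ hω₂.1.2).1⟩
  have b1 := DFPV.FeatureModel.measure_stage1_deviation_le hF hS₁ hm hη hneW hne1
  have b2 := DFPV.FeatureModel.measure_stage2_deviation_le hF hM hY hS₂ hn hη hne2 hne1
  have b3 := DFPV.FeatureModel.measure_heldOut_deviation_le hF hS₃ hn' hη hπ hmeas hind
    (hest₂.mono fun ω hω => hω.1)
  have hsplit : ENNReal.ofReal δ =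
      ENNReal.ofReal (2 * η) + (ENNReal.ofReal (2 * η) + ENNReal.ofReal (2 * η)) := by
    rw [← ENNReal.ofReal_add (by positivity) (by positivity),
      ← ENNReal.ofReal_add (by positivity) (by positivity)]
    congr 1
    rw [hη_def]
    ring
  rw [hsplit]
  refine le_trans (measure_mono_ae ?_) ((measure_union_le _ _).trans (add_le_add b1
    ((measure_union_le _ _).trans (add_le_add b2 b3))))
  -- Outside the three bad events everything is deterministic: the oracle inequalities hold at ω and
  -- force the error below K times the rate.
  filter_upwards [hest₁, hest₂] with ω h₁ h₂ hbad
  by_contra hgood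
  change ¬ (¬ _ ∨ (¬ _ ∨ (_ : ℝ) < _)) at hgood
  rw [not_or, not_or, not_not, not_not, not_lt] at hgood
  obtain ⟨⟨hR₁, g₁⟩, ⟨hR₂, g₂⟩, g₃⟩ := hgood
  refine absurd hbad (not_lt.2 ?_)
  obtain ⟨hq, hθ⟩ := h₂.1
  have hs : ∀ k : ℕ, (0 : ℝ) ≤ 1 / Real.sqrt k := fun k => by positivity
  have hD : ∀ θ ∈ F.ΘW, F.excess1 P θ (est₁ ω θ) ≤ _ := fun θ hθ =>
    DFPV.FeatureModel.excess1_le_of_isStage1Minimizer hF h₁ hlam₁ hreg₁ g₁ hθ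
  have hN := DFPV.FeatureModel.rms_outMean_sub_bridgeCond_le hF hY h₂ (fun θ hθ => (h₁ θ hθ).1) hD
    hlam₂ hreg₂ (hs n) (add_nonneg (by positivity) (mul_nonneg (by positivity) (hs n))) g₂
  have hval := DFPV.Population.abs_value_sub_le hS hI hC hB hY hπ hO hρ
    (DFPV.FeatureModel.measurable_bridge (est₂ ω).1 (est₂ ω).2)
    (DFPV.FeatureModel.memLp_bridge hF hq hθ)
    ((le_iSup₂ (f := fun (r : F.Par2 × F.ParW) (_ : r ∈ F.stage2 ×ˢ F.ΘW) =>
      eLpNorm (fun ω => hstar (P.A ω, P.W ω) - F.bridge r.1 r.2 (P.A ω, P.W ω)) 2 P.μ /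
        eLpNorm (P.μ[fun ω => hstar (P.A ω, P.W ω) - F.bridge r.1 r.2 (P.A ω, P.W ω) | P.sigmaAZ])
          2 P.μ) (est₂ ω) h₂.1).trans hill)
  have ht : (0 : ℝ) ≤ ρ * τ := by positivity
  refine DFPV.error_le_mul_rate (M := M) (DFPV.FeatureModel.kappa1_nonneg)
    (DFPV.FeatureModel.kappa2_nonneg) hR₁ hR₂ (hs m) (hs n) (hs n') (by positivity)
    (by positivity) (by positivity) ht ?_ g₃ (abs_sub_le _ _ _)
  refine hval.trans ?_
  rw [← mul_assoc]
  exact mul_le_mul_of_nonneg_left hN ht
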